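/- Let $(R,\mathfrak m)$ be a regular local ring and let $I\subset R$ be a perfect ideal of height $2$; that is, $I$ is a proper ideal of height $2$ and the projective dimension of the $R$-module $R/I$ equals the grade of $I$ (the maximal length of an $R$-regular sequence contained in $I$). Let $S\cong R/I$, let $\mathfrak n$ be the maximal ideal of the local ring $S$, and let $\mathrm{gr}_{\mathfrak n}(S)=\bigoplus_{i\ge 0}\mathfrak n^i/\mathfrak n^{i+1}$ be its associated graded ring. Let $\mu(I)$ denote the minimal number of generators of $I$. Assume that $\mathrm{gr}_{\mathfrak n}(S)$ is an integral domain. If either $\mu(I)\le 2$, or $\mu(I)=3$ and $I\not\subseteq\mathfrak m^5$, then the ring $\mathrm{gr}_{\mathfrak n}(S)$ is Cohen–Macaulay (that is, it is Noetherian and all its localizations at maximal ideals are Cohen–Macaulay local rings). -/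

import Mathlib

universe u v

open Polynomial

namespace CMGr

/-- The ideal `⨁ i, I ^ (i + 1) tⁱ` (that is, `I · R[It]`) of the Rees algebra
`R[It] = ⨁ i, I ^ i tⁱ`. -/
def reesShiftIdeal {R : Type u} [CommRing R] (I : Ideal R) : Ideal (reesAlgebra I) where
  carrier := {f | ∀ i, (f : R[X]).coeff i ∈ I ^ (i + 1)}
  add_mem' {f g} hf hg i := by
    simpa using Ideal.add_mem _ (hf i) (hg i)
  zero_mem' i := by simp
  smul_mem' c f hf i := by
    change ((c : R[X]) * (f : R[X])).coeff i ∈ I ^ (i + 1)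
    rw [coeff_mul]
    refine Ideal.sum_mem _ ?_
    rintro ⟨j, k⟩ e
    rw [← Finset.HasAntidiagonal.mem_antidiagonal.mp e, add_assoc, pow_add]
    exact Ideal.mul_mem_mul (c.2 j) (hf k)

/-- The associated graded ring `gr_I(R) = ⨁ i, I ^ i / I ^ (i + 1)`, with the multiplication
induced by that of `R`: the quotient of `⨁ i, I ^ i tⁱ` by `⨁ i, I ^ (i + 1) tⁱ`. -/
abbrev AssociatedGradedRing {R : Type u} [CommRing R] (I : Ideal R) : Type u :=
  reesAlgebra I ⧸ reesShiftIdeal I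

/-- The grade of `I` on `R`: the supremum of the lengths of the `R`-regular sequences
contained in `I`. -/
noncomputable def grade {R : Type u} [CommRing R] (I : Ideal R) : ℕ∞ :=
  ⨆ (rs : List R) (_ : (∀ r ∈ rs, r ∈ I) ∧ RingTheory.Sequence.IsRegular R rs), (rs.length : ℕ∞)

/-- A proper ideal `I` of a Noetherian ring `R` is perfect if the projective dimension of the
`R`-module `R / I` equals the grade of `I`. -/
def IsPerfectIdeal {R : Type u} [CommRing R] (I : Ideal R) : Prop :=
  I ≠ ⊤ ∧ CategoryTheory.projectiveDimension (ModuleCat.of R (R ⧸ I)) = (grade I : WithBot ℕ∞)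

/-- The depth of a local ring: the grade of its maximal ideal. -/
noncomputable def depth (R : Type u) [CommRing R] [IsLocalRing R] : ℕ∞ :=
  grade (IsLocalRing.maximalIdeal R)

/-- A Noetherian local ring is Cohen-Macaulay if its depth equals its Krull dimension. -/
def IsCohenMacaulayLocalRing (R : Type u) [CommRing R] [IsLocalRing R] : Prop :=
  IsNoetherianRing R ∧ (depth R : WithBot ℕ∞) = ringKrullDim R

/-- A Noetherian ring is Cohen-Macaulay if all its localizations at maximal ideals are. -/
def IsCohenMacaulayRing (R : Type u) [CommRing R] : Prop :=
  IsNoetherianRing R ∧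
    ∀ (P : Ideal R) [P.IsMaximal], IsCohenMacaulayLocalRing (Localization.AtPrime P)

end CMGr

/-! Let `A` be the polynomial ring over the residue field of `R` in a regular system of parameters;
it is the associated graded ring of `R`. Then gr(S) = A/P, where P consists of the sums of initial
forms of elements of I (`exists_surjective_associatedGradedRing`), and P is prime. It suffices to
show that P is generated by the maximal minors of a 3 × 2 matrix, two of them forming a regular
sequence (`IsLinkedDeterminantal`): the resolution 0 → A² → A³ → P → 0 costs at most two in depth,
while the two minors cost at least two in dimension (`isCohenMacaulayRing_of_surjective`).

The lever is a generator f₁ of least order r. Its initial form F₁ is prime, since a proper factor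
lying in P would have too small a degree (`prime_ini`). Subtracting multiples of f₁ from another
generator makes the initial form of that generator coprime to F₁. If I has two generators, P is then
generated by the two initial forms (`ini_mem_span_pair`).

If I has three generators, Hilbert–Burch makes them the minors f₁, f₂, f₃ of a matrix with rows (aᵢ,
bᵢ), and a₃, b₃ multiply I into (f₁, f₂). Suppose the initial forms α, β of a₃, b₃ are coprime and
not both in P. Then F₁, F₂ are combinations of α, β, and P lies in (F₁, F₂) : (α, β), which linkage
identifies with (F₁, F₂, Δ) for a determinant Δ; and Δ ∈ P because P is prime
(`isLinkedDeterminantal_of_koszulExact`). Coprimality is where r ≤ 4 enters. If some entry in rows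
2, 3 has order one, its initial form is a linear prime. Otherwise r = 4, F₁ is a determinant of
forms of degree two, and a common factor of α and β would divide the prime F₁. -/

namespace CMGr

open IsLocalRing RingTheory.Sequence Pointwise

/-! ### Regular local rings: domains whose maximal ideal is generated by a regular sequence. -/

section RegularLocal

variable {R : Type u} [CommRing R]

/-- As `x ∉ m²`, some minimal generator of `m` occurs in `x` with a unit coefficient and becomes
redundant modulo `x`. -/
lemma spanFinrank_maximalIdeal_quotient_lt [IsLocalRing R] [IsNoetherianRing R] {x : R}
    (hx : x ∈ maximalIdeal R) (hx2 : x ∉ maximalIdeal R ^ 2)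
    [IsLocalRing (R ⧸ Ideal.span {x})] :
    (maximalIdeal (R ⧸ Ideal.span {x})).spanFinrank + 1 ≤ (maximalIdeal R).spanFinrank := by
  classical
  obtain ⟨s, hs, hspan⟩ := Submodule.FG.exists_span_finset_card_eq_spanFinrank
    (maximalIdeal R).fg_of_isNoetherianRing
  have hspan' : Ideal.span (s : Set R) = maximalIdeal R := hspan
  have hx' := hx
  rw [← hspan', Ideal.span, Submodule.mem_span_finset] at hx'
  obtain ⟨c, -, hc⟩ := hx'
  have hsm : ∀ y ∈ s, y ∈ maximalIdeal R := fun y hy ↦ by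
    rw [← hspan']; exact Ideal.subset_span hy
  obtain ⟨y, hy, hyu⟩ : ∃ y ∈ s, c y ∉ maximalIdeal R := by
    by_contra! hcon
    apply hx2
    rw [← hc, pow_two]
    exact Ideal.sum_mem _ fun y hy ↦ Ideal.mul_mem_mul (hcon y hy) (hsm y hy)
  have hunit : IsUnit (c y) := by
    simpa using hyu
  have hmap : maximalIdeal (R ⧸ Ideal.span {x}) =
      Ideal.span ((Ideal.Quotient.mk (Ideal.span {x})) '' (s.erase y : Set R)) := by
    have h1 : (maximalIdeal R).map (Ideal.Quotient.mk (Ideal.span {x})) =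
        maximalIdeal (R ⧸ Ideal.span {x}) :=
      IsLocalRing.map_maximalIdeal_of_surjective _ Ideal.Quotient.mk_surjective
    rw [← h1, ← hspan', Ideal.map_span]
    apply le_antisymm
    · rw [Ideal.span_le]
      rintro _ ⟨z, hz, rfl⟩
      by_cases hzy : z = y
      · subst hzy
        have hz0 : (Ideal.Quotient.mk (Ideal.span {x})) x = 0 :=
          Ideal.Quotient.eq_zero_iff_mem.mpr (Ideal.mem_span_singleton_self x)
        have hc' : Ideal.Quotient.mk (Ideal.span {x}) (∑ a ∈ s, c a • a) = 0 := by rw [hc, hz0]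
        rw [← Finset.add_sum_erase _ _ hy, map_add, smul_eq_mul, map_mul] at hc'
        rw [SetLike.mem_coe, ← Ideal.unit_mul_mem_iff_mem _
          (hunit.map (Ideal.Quotient.mk (Ideal.span {x}))), eq_neg_of_add_eq_zero_left hc',
          neg_mem_iff, map_sum]
        refine Ideal.sum_mem _ fun w hw ↦ ?_
        rw [smul_eq_mul, map_mul]
        exact Ideal.mul_mem_left _ _ (Ideal.subset_span ⟨w, hw, rfl⟩)
      · exact Ideal.subset_span ⟨z, by simp [hzy, Finset.mem_coe.mp hz], rfl⟩
    · refine Ideal.span_mono (Set.image_mono ?_)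
      exact_mod_cast Finset.erase_subset _ _
  rw [hmap]
  have h2 := Submodule.spanFinrank_span_le_ncard_of_finite (R := R ⧸ Ideal.span {x})
    ((s.erase y).finite_toSet.image (Ideal.Quotient.mk (Ideal.span {x})))
  have h3 := Set.ncard_image_le (f := Ideal.Quotient.mk (Ideal.span {x})) (s.erase y).finite_toSet
  rw [Set.ncard_coe_finset, Finset.card_erase_of_mem hy] at h3
  have h4 : 0 < s.card := Finset.card_pos.mpr ⟨y, hy⟩
  rw [← hs]
  change (Submodule.span _ _).spanFinrank + 1 ≤ _
  omega

lemma isRegularLocalRing_quotient [IsRegularLocalRing R] {x : R}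
    (hx : x ∈ maximalIdeal R) (hx2 : x ∉ maximalIdeal R ^ 2) :
    IsRegularLocalRing (R ⧸ Ideal.span {x}) ∧
    ∀ [IsLocalRing (R ⧸ Ideal.span {x})],
      (maximalIdeal (R ⧸ Ideal.span {x})).spanFinrank + 1 = (maximalIdeal R).spanFinrank := by
  have : Nontrivial (R ⧸ Ideal.span {x}) := Ideal.Quotient.nontrivial_iff.mpr fun h ↦ by
    have := (Ideal.span_singleton_le_iff_mem _).mpr hx
    rw [h, top_le_iff] at this
    exact Ideal.IsPrime.ne_top' this
  have : IsLocalRing (R ⧸ Ideal.span {x}) := .of_surjective' _ Ideal.Quotient.mk_surjective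
  have h1 := spanFinrank_maximalIdeal_quotient_lt hx hx2
  have h2 : ringKrullDim R ≤ ringKrullDim (R ⧸ Ideal.span {x}) + 1 := by
    have := ringKrullDim_le_ringKrullDim_quotSMulTop_succ hx
    rwa [← Submodule.ideal_span_singleton_smul, Ideal.smul_eq_mul, Ideal.mul_top] at this
  have h3 := IsRegularLocalRing.spanFinrank_maximalIdeal (R := R)
  have h4 := ringKrullDim_le_spanFinrank_maximalIdeal (R := R ⧸ Ideal.span {x})
  have h5 : ((maximalIdeal R).spanFinrank : WithBot ℕ∞) ≤
      ((maximalIdeal (R ⧸ Ideal.span {x})).spanFinrank : WithBot ℕ∞) + 1 := by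
    rw [h3]; exact h2.trans (by gcongr)
  have h6 : (maximalIdeal R).spanFinrank ≤ (maximalIdeal (R ⧸ Ideal.span {x})).spanFinrank + 1 := by
    exact_mod_cast h5
  have h7 : (maximalIdeal (R ⧸ Ideal.span {x})).spanFinrank + 1 = (maximalIdeal R).spanFinrank := by
    omega
  refine ⟨IsRegularLocalRing.of_spanFinrank_maximalIdeal_le _ ?_, fun {inst} ↦ h7⟩
  rw [← h3, ← h7] at h2
  push_cast at h2
  exact (ENat.WithBot.add_le_add_one_right_iff).mp h2

/-- Prime avoidance, which tolerates the non-prime ideal `m²`: Nakayama excludes `m ⊆ m²`, and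
positive dimension excludes that `m` is a minimal prime. -/
lemma exists_mem_maximalIdeal_notMem_minimalPrimes [IsRegularLocalRing R]
    (h : (maximalIdeal R).spanFinrank ≠ 0) :
    ∃ x ∈ maximalIdeal R, x ∉ maximalIdeal R ^ 2 ∧ ∀ p ∈ minimalPrimes R, x ∉ p := by
  classical
  have hfin := minimalPrimes.finite_of_isNoetherianRing R
  by_contra! hcon
  have hdim := IsRegularLocalRing.spanFinrank_maximalIdeal (R := R)
  have hsub : ((maximalIdeal R : Ideal R) : Set R) ⊆
      ⋃ i ∈ ((insert (maximalIdeal R ^ 2) hfin.toFinset : Finset (Ideal R)) : Set (Ideal R)),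
        ((id i : Ideal R) : Set R) := by
    intro x hx
    by_cases hx2 : x ∈ maximalIdeal R ^ 2
    · simp [hx2]
    · obtain ⟨p, hp, hxp⟩ := hcon x hx hx2
      simp only [Finset.coe_insert, Set.Finite.coe_toFinset, Set.mem_insert_iff, id_eq,
        Set.iUnion_iUnion_eq_or_left, Set.mem_union, Set.mem_iUnion]
      exact Or.inr ⟨p, hp, hxp⟩
  rw [Ideal.subset_union_prime (maximalIdeal R ^ 2) (maximalIdeal R ^ 2)] at hsub
  · obtain ⟨p, hp, hle⟩ := hsub
    rw [Finset.mem_insert, Set.Finite.mem_toFinset] at hp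
    obtain rfl | hp := hp
    · apply h
      have h0 : maximalIdeal R = ⊥ := by
        apply Submodule.eq_bot_of_le_smul_of_le_jacobson_bot (maximalIdeal R) _
          (maximalIdeal R).fg_of_isNoetherianRing
        · rw [smul_eq_mul, ← pow_two]; exact hle
        · exact (IsLocalRing.jacobson_eq_maximalIdeal ⊥ bot_ne_top).ge
      rw [h0]; exact Submodule.spanFinrank_bot
    · have hpp : p.IsPrime := hp.1.1
      have : maximalIdeal R = p := le_antisymm hle (IsLocalRing.le_maximalIdeal hpp.ne_top)
      have hh : (maximalIdeal R).height = 0 := by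
        rw [this, Ideal.height_eq_zero_iff]; exact hp
      have := maximalIdeal_height_eq_ringKrullDim (R := R)
      rw [hh, ← hdim] at this
      exact h (by exact_mod_cast this.symm)
  · intro i hi hi2 _
    rw [Finset.mem_insert, Set.Finite.mem_toFinset] at hi
    exact (hi.resolve_left hi2).1.1

/-- A minimal prime `p` inside `(x)` satisfies `p = x p` because `x ∉ p`, so Nakayama gives `p = 0`.
-/
lemma isDomain_of_isDomain_quotient [IsLocalRing R] [IsNoetherianRing R] {x : R}
    (hx : x ∈ maximalIdeal R) (hxp : ∀ p ∈ minimalPrimes R, x ∉ p)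
    [IsDomain (R ⧸ Ideal.span {x})] : IsDomain R := by
  have hprime : (Ideal.span {x}).IsPrime := (Ideal.Quotient.isDomain_iff_prime _).mp inferInstance
  obtain ⟨p, hp, hle⟩ := Ideal.exists_minimalPrimes_le (I := ⊥) (J := Ideal.span {x}) bot_le
  have hpp : p.IsPrime := hp.1.1
  have hp0 : p = ⊥ := by
    apply Submodule.eq_bot_of_le_smul_of_le_jacobson_bot (maximalIdeal R) _
      p.fg_of_isNoetherianRing
    · intro y hy
      obtain ⟨z, rfl⟩ := Ideal.mem_span_singleton'.mp (hle hy)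
      rw [mul_comm, smul_eq_mul]
      exact Ideal.mul_mem_mul hx ((hpp.mem_or_mem hy).resolve_right (hxp p hp))
    · exact (IsLocalRing.jacobson_eq_maximalIdeal ⊥ bot_ne_top).ge
  subst hp0
  exact (IsDomain.of_bot_isPrime R)

/-- Both claims go in one induction: the domain property climbs from `R / (x)` to `R`, and it makes
`x` a nonzerodivisor. -/
lemma exists_isWeaklyRegular_ofList_eq_maximalIdeal_aux (n : ℕ) :
    ∀ (R : Type u) [CommRing R] [IsRegularLocalRing R], (maximalIdeal R).spanFinrank = n →
      IsDomain R ∧ ∃ rs : List R, rs.length = n ∧ Ideal.ofList rs = maximalIdeal R ∧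
        IsWeaklyRegular R rs := by
  induction n with
  | zero =>
    intro R _ _ h
    rw [Submodule.spanFinrank_eq_zero_iff_eq_bot (maximalIdeal R).fg_of_isNoetherianRing] at h
    have hf : IsField R := IsLocalRing.isField_iff_maximalIdeal_eq.mpr h
    exact ⟨hf.isDomain, [], rfl, by rw [h, Ideal.ofList_nil], .nil _ _⟩
  | succ n ih =>
    intro R _ _ h
    obtain ⟨x, hx, hx2, hxp⟩ := exists_mem_maximalIdeal_notMem_minimalPrimes (R := R) (by omega)
    obtain ⟨hreg, hn⟩ := isRegularLocalRing_quotient hx hx2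
    obtain ⟨hdom, rs', hlen, hspan, hrs'⟩ := ih (R ⧸ Ideal.span {x}) (by have := hn; omega)
    have hD : IsDomain R := isDomain_of_isDomain_quotient hx hxp
    refine ⟨hD, ?_⟩
    obtain ⟨rs, rfl⟩ : ∃ rs : List R, rs.map (Ideal.Quotient.mk (Ideal.span {x})) = rs' :=
      ⟨rs'.map (Function.surjInv Ideal.Quotient.mk_surjective), by
        simp [Function.comp_def, Function.surjInv_eq]⟩
    refine ⟨x :: rs, by simpa using hlen, ?_, ?_⟩
    · rw [Ideal.ofList_cons]
      have h1 : (maximalIdeal R).map (Ideal.Quotient.mk (Ideal.span {x})) =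
          maximalIdeal (R ⧸ Ideal.span {x}) :=
        IsLocalRing.map_maximalIdeal_of_surjective _ Ideal.Quotient.mk_surjective
      rw [← h1, ← Ideal.map_ofList] at hspan
      have h2 := congrArg (Ideal.comap (Ideal.Quotient.mk (Ideal.span {x}))) hspan
      rw [Ideal.comap_map_of_surjective _ Ideal.Quotient.mk_surjective,
        Ideal.comap_map_of_surjective _ Ideal.Quotient.mk_surjective, ← RingHom.ker_eq_comap_bot,
        Ideal.mk_ker, sup_comm] at h2
      rw [h2, sup_eq_left, Ideal.span_singleton_le_iff_mem]
      exact hx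
    · have hx0 : x ≠ 0 := fun h0 ↦ hx2 (by rw [h0]; exact Ideal.zero_mem _)
      refine .cons (fun a b hab ↦ mul_left_cancel₀ hx0 hab) ?_
      have h1 : IsWeaklyRegular (R ⧸ Ideal.span {x}) rs :=
        (isWeaklyRegular_map_algebraMap_iff (R ⧸ Ideal.span {x}) (R ⧸ Ideal.span {x}) rs).mp hrs'
      have e : x • (⊤ : Submodule R R) = Ideal.span {x} := by
        rw [← Submodule.ideal_span_singleton_smul, Ideal.smul_eq_mul, Ideal.mul_top]
      exact ((Submodule.quotEquivOfEq _ _ e).isWeaklyRegular_congr rs).mpr h1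

variable (R) in
theorem exists_isWeaklyRegular_ofList_eq_maximalIdeal [IsRegularLocalRing R] :
    ∃ rs : List R, (rs.length : WithBot ℕ∞) = ringKrullDim R ∧
      Ideal.ofList rs = maximalIdeal R ∧ IsWeaklyRegular R rs := by
  obtain ⟨-, rs, h1, h2⟩ := exists_isWeaklyRegular_ofList_eq_maximalIdeal_aux _ R rfl
  exact ⟨rs, by rw [h1, IsRegularLocalRing.spanFinrank_maximalIdeal], h2⟩

theorem isDomain_of_isRegularLocalRing [IsRegularLocalRing R] : IsDomain R :=
  (exists_isWeaklyRegular_ofList_eq_maximalIdeal_aux _ R rfl).1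

end RegularLocal
end CMGr

namespace MvPolynomial

/-! ### Regular sequences are quasi-regular. -/

section QuasiRegular

open RingTheory.Sequence CMGr

variable {R : Type u} [CommRing R]

/-- A family is quasi-regular if every homogeneous relation among its members has coefficients
in the ideal it generates. -/
def IsQuasiRegular {ι : Type*} (x : ι → R) : Prop :=
  ∀ (n : ℕ) (F : MvPolynomial ι R), F.IsHomogeneous n → eval x F = 0 →
    F ∈ (Ideal.span (Set.range x)).map (C : R →+* MvPolynomial ι R)

lemma eval_mem_pow_of_isHomogeneous {ι : Type*} {x : ι → R} {n : ℕ} {F : MvPolynomial ι R}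
    (hF : F.IsHomogeneous n) : eval x F ∈ Ideal.span (Set.range x) ^ n :=
  (Ideal.mem_span_pow_iff_exists_isHomogeneous x _).mpr ⟨F, hF, rfl⟩

lemma eval_mem_pow_succ_of_mem_map_C {ι : Type*} {x : ι → R} {n : ℕ} {F : MvPolynomial ι R}
    (hF : F.IsHomogeneous n) (hI : F ∈ (Ideal.span (Set.range x)).map (C : R →+* MvPolynomial ι R)) :
    eval x F ∈ Ideal.span (Set.range x) ^ (n + 1) := by
  rw [F.as_sum, map_sum]
  refine Ideal.sum_mem _ fun d hd ↦ ?_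
  have h1 : monomial d (coeff d F) = C (coeff d F) * monomial d 1 := by
    rw [C_mul_monomial, mul_one]
  rw [h1, map_mul, eval_C, pow_succ']
  refine Ideal.mul_mem_mul (mem_map_C_iff.mp hI d) (eval_mem_pow_of_isHomogeneous ?_)
  refine isHomogeneous_monomial _ ?_
  by_contra hne
  exact (mem_support_iff.mp hd) (hF.coeff_eq_zero hne)

/-- An element of `J ^ (n + 1)` is the value of a form of degree `n` with coefficients in `J`;
subtracting that form reduces to a relation. The degree is fixed because the induction in
`IsQuasiRegular.cons` knows one degree at a time. -/
lemma mem_map_C_of_eval_mem_pow_succ {ι : Type*} {x : ι → R} {n : ℕ}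
    (hx : ∀ (F : MvPolynomial ι R), F.IsHomogeneous n → eval x F = 0 →
      F ∈ (Ideal.span (Set.range x)).map (C : R →+* MvPolynomial ι R))
    {F : MvPolynomial ι R} (hF : F.IsHomogeneous n)
    (h : eval x F ∈ Ideal.span (Set.range x) ^ (n + 1)) :
    F ∈ (Ideal.span (Set.range x)).map (C : R →+* MvPolynomial ι R) := by
  have key : ∀ y ∈ Ideal.span (Set.range x) ^ (n + 1), ∃ H : MvPolynomial ι R,
      H.IsHomogeneous n ∧ H ∈ (Ideal.span (Set.range x)).map (C : R →+* MvPolynomial ι R) ∧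
        eval x H = y := by
    intro y hy
    rw [pow_succ'] at hy
    induction hy using Submodule.mul_induction_on' with
    | mem_mul_mem c hc z hz =>
      obtain ⟨G, hG, rfl⟩ := (Ideal.mem_span_pow_iff_exists_isHomogeneous x _).mp hz
      exact ⟨C c * G, hG.C_mul c, Ideal.mul_mem_right _ _ (Ideal.mem_map_of_mem _ hc), by simp⟩
    | add y _ z _ hy hz =>
      obtain ⟨G, hG, hG', rfl⟩ := hy
      obtain ⟨H, hH, hH', rfl⟩ := hz
      exact ⟨G + H, hG.add hH, Ideal.add_mem _ hG' hH', by simp⟩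
  obtain ⟨H, hH, hH', he⟩ := key _ h
  have := hx (F - H) (hF.sub hH) (by rw [map_sub, he, sub_self])
  simpa using Ideal.add_mem _ this hH'

/-- By induction `z` is the value of a form `G` of degree `n`; quasi-regularity puts the
coefficients of `y G` into the ideal, where `y` cancels. -/
lemma IsQuasiRegular.mem_pow_of_mul_mem_pow {ι : Type*} {x : ι → R} (hx : IsQuasiRegular x) {y : R}
    (hy : ∀ z, y * z ∈ Ideal.span (Set.range x) → z ∈ Ideal.span (Set.range x)) (n : ℕ) {z : R}
    (hz : y * z ∈ Ideal.span (Set.range x) ^ n) : z ∈ Ideal.span (Set.range x) ^ n := by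
  induction n with
  | zero => simp
  | succ n ih =>
    obtain ⟨G, hG, rfl⟩ := (Ideal.mem_span_pow_iff_exists_isHomogeneous x _).mp
      (ih (Ideal.pow_le_pow_right n.le_succ hz))
    refine eval_mem_pow_succ_of_mem_map_C hG ?_
    have h1 : C y * G ∈ (Ideal.span (Set.range x)).map (C : R →+* MvPolynomial ι R) :=
      mem_map_C_of_eval_mem_pow_succ (hx n) (hG.C_mul y) (by simpa using hz)
    rw [mem_map_C_iff] at h1 ⊢
    intro d
    apply hy
    simpa using h1 d

lemma finSuccEquiv_rename_succ {n : ℕ} (G : MvPolynomial (Fin n) R) :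
    finSuccEquiv R n (rename Fin.succ G) = Polynomial.C G := by
  induction G using MvPolynomial.induction_on with
  | C a => rw [rename_C]; exact ((AlgEquiv.symm_apply_eq _).mp
      (RingHom.congr_fun (finSuccEquiv_comp_C_eq_C (R := R) n) a)).symm
  | add p q hp hq => rw [map_add, map_add, hp, hq, map_add]
  | mul_X p i hp => rw [map_mul, map_mul, hp, rename_X, finSuccEquiv_X_succ, map_mul]

lemma exists_eq_rename_add_X_mul {n r : ℕ} {F : MvPolynomial (Fin (n + 1)) R}
    (hF : F.IsHomogeneous (r + 1)) :
    ∃ (G : MvPolynomial (Fin n) R) (H : MvPolynomial (Fin (n + 1)) R), G.IsHomogeneous (r + 1) ∧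
      H.IsHomogeneous r ∧ F = rename Fin.succ G + X 0 * H := by
  set p := finSuccEquiv R n F with hp
  have hG : (p.coeff 0).IsHomogeneous (r + 1) :=
    hF.finSuccEquiv_coeff_isHomogeneous 0 (r + 1) (zero_add _)
  have hFe : F = rename Fin.succ (p.coeff 0) + X 0 * (finSuccEquiv R n).symm p.divX := by
    apply (finSuccEquiv R n).injective
    rw [map_add, map_mul, finSuccEquiv_rename_succ, finSuccEquiv_X_zero, AlgEquiv.apply_symm_apply,
      ← hp, add_comm]
    exact (Polynomial.X_mul_divX_add p).symm
  refine ⟨p.coeff 0, (finSuccEquiv R n).symm p.divX, hG, ?_, hFe⟩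
  set H := (finSuccEquiv R n).symm p.divX
  have h1 : (X 0 * H).IsHomogeneous (r + 1) := by
    rw [← sub_eq_iff_eq_add'.mpr hFe]
    exact hF.sub hG.rename_isHomogeneous
  intro d hd
  have h2 : coeff (Finsupp.single 0 1 + d) (X 0 * H) ≠ 0 := by rwa [coeff_X_mul]
  have := h1 h2
  rw [map_add, Finsupp.weight_single] at this
  simp at this
  omega

/-- Write a relation as `G + X₀ H` with `G` free of `X₀`. Then `y` times the value of `H` lies in a
power of the old ideal, hence so does that value, say as the value of `h`. Induction on the degree
treats `H`, quasi-regularity of `x` treats `G + y h`. The new element sits at index 0 because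
`finSuccEquiv` splits off that variable. -/
lemma IsQuasiRegular.cons {n : ℕ} {x : Fin n → R} (hx : IsQuasiRegular x) {y : R}
    (hy : ∀ z, y * z ∈ Ideal.span (Set.range x) → z ∈ Ideal.span (Set.range x)) :
    IsQuasiRegular (Fin.cons y x : Fin (n + 1) → R) := by
  have hle : Ideal.span (Set.range x) ≤
      Ideal.span (Set.range (Fin.cons y x : Fin (n + 1) → R)) := by
    refine Ideal.span_mono ?_
    rintro _ ⟨i, rfl⟩
    exact ⟨i.succ, by simp⟩
  have hyJ : y ∈ Ideal.span (Set.range (Fin.cons y x : Fin (n + 1) → R)) :=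
    Ideal.subset_span ⟨0, by simp⟩
  intro r
  induction r with
  | zero =>
    intro F hF h0
    rw [← totalDegree_zero_iff_isHomogeneous, totalDegree_eq_zero_iff_eq_C] at hF
    rw [hF, eval_C] at h0
    rw [hF, h0, map_zero]
    exact Ideal.zero_mem _
  | succ r ih =>
    intro F hF h0
    obtain ⟨G, H, hG, hH, rfl⟩ := exists_eq_rename_add_X_mul hF
    have he : eval (Fin.cons y x : Fin (n + 1) → R) (rename Fin.succ G) = eval x G := by
      rw [eval_rename]; rfl
    rw [map_add, map_mul, eval_X, he, Fin.cons_zero] at h0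
    have h1 : y * eval (Fin.cons y x : Fin (n + 1) → R) H ∈ Ideal.span (Set.range x) ^ (r + 1) := by
      rw [eq_neg_of_add_eq_zero_right h0, neg_mem_iff]
      exact eval_mem_pow_of_isHomogeneous hG
    have h2 := hx.mem_pow_of_mul_mem_pow hy _ h1
    have h3 := mem_map_C_of_eval_mem_pow_succ ih hH (Ideal.pow_right_mono hle _ h2)
    obtain ⟨h, hh, heq⟩ := (Ideal.mem_span_pow_iff_exists_isHomogeneous x _).mp h2
    have h4 : G + C y * h ∈ (Ideal.span (Set.range x)).map (C : R →+* MvPolynomial (Fin n) R) :=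
      hx (r + 1) _ (hG.add (hh.C_mul y)) (by rw [map_add, map_mul, eval_C, heq, h0])
    have h5 : rename Fin.succ (G + C y * h) ∈ (Ideal.span (Set.range
        (Fin.cons y x : Fin (n + 1) → R))).map (C : R →+* MvPolynomial (Fin (n + 1)) R) := by
      have := Ideal.mem_map_of_mem (rename Fin.succ : MvPolynomial (Fin n) R →ₐ[R] _).toRingHom h4
      rw [Ideal.map_map] at this
      have hc : ((rename Fin.succ : MvPolynomial (Fin n) R →ₐ[R]
          MvPolynomial (Fin (n + 1)) R).toRingHom).comp C = C := by
        ext1 a; simp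
      rw [hc] at this
      exact Ideal.map_mono hle this
    rw [map_add, map_mul, rename_C] at h5
    refine Ideal.add_mem _ ?_ (Ideal.mul_mem_left _ _ h3)
    exact (Ideal.add_mem_iff_left _ (Ideal.mul_mem_right _ _ (Ideal.mem_map_of_mem _ hyJ))).mp h5

lemma exists_isQuasiRegular_of_isWeaklyRegular (rs : List R) (h : IsWeaklyRegular R rs) :
    ∃ x : Fin rs.length → R, Ideal.span (Set.range x) = Ideal.ofList rs ∧ IsQuasiRegular x := by
  suffices ∀ m, rs.length = m → ∃ x : Fin m → R,
    Ideal.span (Set.range x) = Ideal.ofList rs ∧ IsQuasiRegular x from this _ rfl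
  induction rs using List.reverseRecOn with
  | nil =>
    rintro _ rfl
    refine ⟨Fin.elim0, by simp [Set.range_eq_empty], fun n F hF h0 ↦ ?_⟩
    have : IsEmpty (Fin ([] : List R).length) := inferInstanceAs (IsEmpty (Fin 0))
    have : F = C (coeff 0 F) := eq_C_of_isEmpty F
    rw [this, eval_C] at h0
    rw [this, h0, map_zero]
    exact Ideal.zero_mem _
  | append_singleton rs y ih =>
    rintro _ rfl
    rw [isWeaklyRegular_append_iff, isWeaklyRegular_singleton_iff] at h
    obtain ⟨x, hspan, hx⟩ := ih h.1 _ rfl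
    rw [List.length_append, List.length_singleton]
    refine ⟨Fin.cons y x, ?_, hx.cons ?_⟩
    · rw [Fin.range_cons, Ideal.span_insert, hspan, Ideal.ofList_append, Ideal.ofList_singleton,
        sup_comm]
    · intro z hz
      have := h.2
      rw [smul_eq_mul, Ideal.mul_top] at this
      rw [hspan] at hz ⊢
      exact (isSMulRegular_quotient_iff_mem_of_smul_mem _ _).mp this z hz

open IsLocalRing in
variable (R) in
theorem exists_isQuasiRegular_span_eq_maximalIdeal [IsRegularLocalRing R] :
    ∃ (d : ℕ) (x : Fin d → R), Ideal.span (Set.range x) = maximalIdeal R ∧ IsQuasiRegular x := by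
  obtain ⟨rs, -, h1, h2⟩ := exists_isWeaklyRegular_ofList_eq_maximalIdeal R
  obtain ⟨x, h3, h4⟩ := exists_isQuasiRegular_of_isWeaklyRegular rs h2
  exact ⟨_, x, h3.trans h1, h4⟩

end QuasiRegular
end MvPolynomial

namespace MvPolynomial

/-! ### Homogeneous components of products, and Koszul pairs. -/

section Graded

variable {σ k : Type*} [CommRing k]

lemma homogeneousComponent_mul_of_isHomogeneous {s n : ℕ} {G : MvPolynomial σ k}
    (hG : G.IsHomogeneous s) (u : MvPolynomial σ k) :
    homogeneousComponent n (G * u) = if s ≤ n then G * homogeneousComponent (n - s) u else 0 := by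
  conv_lhs => rw [← sum_homogeneousComponent u, Finset.mul_sum, map_sum]
  have h1 : ∀ i ∈ Finset.range (u.totalDegree + 1),
      homogeneousComponent n (G * homogeneousComponent i u) =
        if s + i = n then G * homogeneousComponent i u else 0 := fun i _ ↦ by
    rw [homogeneousComponent_of_mem (hG.mul (homogeneousComponent_isHomogeneous i u))]
    simp only [eq_comm]
  rw [Finset.sum_congr rfl h1]
  split_ifs with h
  · by_cases hn : n - s ∈ Finset.range (u.totalDegree + 1)
    · rw [Finset.sum_eq_single_of_mem _ hn fun i _ hi ↦ if_neg (by omega), if_pos (by omega)]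
    · rw [Finset.sum_eq_zero fun i hi ↦ ?_, homogeneousComponent_eq_zero, mul_zero]
      · rw [Finset.mem_range] at hn; omega
      · rw [if_neg]; rintro rfl; apply hn; simpa using hi
  · exact Finset.sum_eq_zero fun i _ ↦ if_neg (by omega)

end Graded

end MvPolynomial

namespace CMGr

/-- Exactness in the middle of the Koszul complex of a pair of elements. -/
def KoszulExact {A : Type*} [CommRing A] (F G : A) : Prop :=
  ∀ p q, F * p = G * q → ∃ u, p = G * u ∧ q = F * u

lemma KoszulExact.of_isRelPrime {A : Type*} [CommRing A] [IsDomain A] [DecompositionMonoid A]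
    {F G : A} (h : IsRelPrime F G) : KoszulExact F G := by
  intro p q hpq
  by_cases hG : G = 0
  · subst hG
    obtain ⟨F, rfl⟩ := isRelPrime_zero_right.mp h
    rw [zero_mul, Units.mul_right_eq_zero] at hpq
    exact ⟨↑F⁻¹ * q, by simp [hpq], by simp⟩
  · obtain ⟨u, rfl⟩ := h.symm.dvd_of_dvd_mul_left (Dvd.intro _ hpq.symm)
    exact ⟨u, rfl, mul_left_cancel₀ hG (by rw [← hpq]; ring)⟩

end CMGr

namespace MvPolynomial
open IsLocalRing CMGr

/-! ### Initial forms with respect to a regular system of parameters. -/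

section Initial

variable {R : Type u} [CommRing R] [IsLocalRing R] {ι : Type*} {x : ι → R}

open Classical in
/-- The initial form of degree `r` of `f`, as a polynomial in the given generators of the
maximal ideal. -/
noncomputable def ini (x : ι → R) (r : ℕ) (f : R) : MvPolynomial ι (ResidueField R) :=
  if h : ∃ F : MvPolynomial ι R, F.IsHomogeneous r ∧ eval x F = f then
    map (residue R) h.choose else 0

variable (x) in
/-- Quasi-regular generators of the maximal ideal. -/
structure IsRegularParameters : Prop where
  span_eq : Ideal.span (Set.range x) = maximalIdeal R
  quasi : IsQuasiRegular x

lemma ini_isHomogeneous (r : ℕ) (f : R) : (ini x r f).IsHomogeneous r := by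
  unfold ini
  split_ifs with h
  · exact h.choose_spec.1.map _
  · exact isHomogeneous_zero _ _ _

variable (hx : IsRegularParameters x)
include hx

lemma IsRegularParameters.exists_eval_eq {r : ℕ} {f : R} (hf : f ∈ maximalIdeal R ^ r) :
    ∃ F : MvPolynomial ι R, F.IsHomogeneous r ∧ eval x F = f := by
  rwa [← hx.span_eq, Ideal.mem_span_pow_iff_exists_isHomogeneous] at hf

lemma IsRegularParameters.eval_mem {r : ℕ} {F : MvPolynomial ι R} (hF : F.IsHomogeneous r) :
    eval x F ∈ maximalIdeal R ^ r := by
  rw [← hx.span_eq]; exact eval_mem_pow_of_isHomogeneous hF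

omit hx in
lemma map_residue_eq_zero_iff (F : MvPolynomial ι R) :
    map (residue R) F = 0 ↔ F ∈ (maximalIdeal R).map (C : R →+* MvPolynomial ι R) := by
  rw [mem_map_C_iff, MvPolynomial.ext_iff]
  simp [coeff_map, residue_eq_zero_iff]

/-- Independence of the chosen representative: two representatives differ by a homogeneous relation,
whose coefficients lie in the maximal ideal by quasi-regularity. -/
lemma ini_eval {r : ℕ} {F : MvPolynomial ι R} (hF : F.IsHomogeneous r) :
    ini x r (eval x F) = map (residue R) F := by
  have h : ∃ G : MvPolynomial ι R, G.IsHomogeneous r ∧ eval x G = eval x F := ⟨F, hF, rfl⟩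
  rw [ini, dif_pos h, ← sub_eq_zero, ← map_sub, map_residue_eq_zero_iff, ← hx.span_eq]
  exact hx.quasi r _ (h.choose_spec.1.sub hF) (by rw [map_sub, h.choose_spec.2, sub_self])

lemma ini_add {r : ℕ} {f g : R} (hf : f ∈ maximalIdeal R ^ r) (hg : g ∈ maximalIdeal R ^ r) :
    ini x r (f + g) = ini x r f + ini x r g := by
  obtain ⟨F, hF, rfl⟩ := hx.exists_eval_eq hf
  obtain ⟨G, hG, rfl⟩ := hx.exists_eval_eq hg
  rw [← map_add, ini_eval hx hF, ini_eval hx hG, ini_eval hx (hF.add hG), map_add]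

lemma ini_neg {r : ℕ} {f : R} (hf : f ∈ maximalIdeal R ^ r) :
    ini x r (-f) = -ini x r f := by
  obtain ⟨F, hF, rfl⟩ := hx.exists_eval_eq hf
  rw [← map_neg, ini_eval hx hF, ini_eval hx hF.neg, map_neg]

lemma ini_sub {r : ℕ} {f g : R} (hf : f ∈ maximalIdeal R ^ r) (hg : g ∈ maximalIdeal R ^ r) :
    ini x r (f - g) = ini x r f - ini x r g := by
  rw [sub_eq_add_neg, ini_add hx hf (neg_mem hg), ini_neg hx hg, sub_eq_add_neg]

lemma ini_mul {r s : ℕ} {f g : R} (hf : f ∈ maximalIdeal R ^ r) (hg : g ∈ maximalIdeal R ^ s) :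
    ini x (r + s) (f * g) = ini x r f * ini x s g := by
  obtain ⟨F, hF, rfl⟩ := hx.exists_eval_eq hf
  obtain ⟨G, hG, rfl⟩ := hx.exists_eval_eq hg
  rw [← map_mul, ini_eval hx hF, ini_eval hx hG, ini_eval hx (hF.mul hG), map_mul]

lemma ini_eq_zero_iff {r : ℕ} {f : R} (hf : f ∈ maximalIdeal R ^ r) :
    ini x r f = 0 ↔ f ∈ maximalIdeal R ^ (r + 1) := by
  obtain ⟨F, hF, rfl⟩ := hx.exists_eval_eq hf
  rw [ini_eval hx hF, map_residue_eq_zero_iff, ← hx.span_eq]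
  exact ⟨eval_mem_pow_succ_of_mem_map_C hF, mem_map_C_of_eval_mem_pow_succ (hx.quasi r) hF⟩

omit hx in
lemma exists_map_residue_eq {r : ℕ} {G : MvPolynomial ι (ResidueField R)} (hG : G.IsHomogeneous r) :
    ∃ F : MvPolynomial ι R, F.IsHomogeneous r ∧ map (residue R) F = G := by
  obtain ⟨F, rfl⟩ := map_surjective (residue R) residue_surjective G
  refine ⟨homogeneousComponent r F, homogeneousComponent_isHomogeneous r F, ?_⟩
  rw [← homogeneousComponent_eq_self hG]
  ext d
  simp only [coeff_map, coeff_homogeneousComponent]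
  split_ifs <;> simp

lemma exists_ini_eq {r : ℕ} {G : MvPolynomial ι (ResidueField R)} (hG : G.IsHomogeneous r) :
    ∃ f ∈ maximalIdeal R ^ r, ini x r f = G := by
  obtain ⟨F, hF, rfl⟩ := exists_map_residue_eq hG
  exact ⟨eval x F, hx.eval_mem hF, ini_eval hx hF⟩

/-- The subtraction `j - r` is truncated. For `j < r` the product already lies in `m ^ (j + 1)`, so
the factor contributed by `a` has to be replaced by zero. -/
lemma ini_mul_of_mem_sub {r j : ℕ} {a f : R} (ha : a ∈ maximalIdeal R ^ (j - r))
    (hf : f ∈ maximalIdeal R ^ r) :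
    ini x j (a * f) = (if r ≤ j then ini x (j - r) a else 0) * ini x r f := by
  split_ifs with h
  · rw [← ini_mul hx ha hf, Nat.sub_add_cancel h]
  · rw [zero_mul, ini_eq_zero_iff hx]
    · exact Ideal.pow_le_pow_right (by omega) (Ideal.mul_mem_left _ a hf)
    · exact Ideal.pow_le_pow_right (by omega) (Ideal.mul_mem_left _ a hf)

lemma mem_of_ite_ini_eq_zero {r j : ℕ} {a : R} (ha : a ∈ maximalIdeal R ^ (j - r))
    (h : (if r ≤ j then ini x (j - r) a else 0) = 0) : a ∈ maximalIdeal R ^ (j + 1 - r) := by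
  split_ifs at h with hr
  · rw [ini_eq_zero_iff hx ha] at h
    rwa [Nat.sub_add_comm hr]
  · rwa [show j + 1 - r = j - r by omega]

omit hx in
lemma mul_mem_pow_of_mem_sub {r j : ℕ} {a f : R} (ha : a ∈ maximalIdeal R ^ (j - r))
    (hf : f ∈ maximalIdeal R ^ r) : a * f ∈ maximalIdeal R ^ j := by
  have := Ideal.mul_mem_mul ha hf
  rw [← pow_add] at this
  exact Ideal.pow_le_pow_right (by omega) this

/-- Write `h = a f + b g` and raise the orders of `a`, `b` step by step. While the terms have order
below `t`, their leading parts cancel, which is a syzygy of the two initial forms; it is a Koszul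
syzygy, and lifting its coefficient to `w` allows `(a, b)` to be replaced by `(a - g w, b + f w)`.
-/
theorem ini_mem_span_pair {f g h : R} {r s t : ℕ} (hf : f ∈ maximalIdeal R ^ r)
    (hg : g ∈ maximalIdeal R ^ s) (hK : KoszulExact (ini x r f) (ini x s g))
    (hh : h ∈ maximalIdeal R ^ t) (hfg : h ∈ Ideal.span {f, g}) :
    ini x t h ∈ Ideal.span {ini x r f, ini x s g} := by
  suffices ∀ j ≤ t, ∃ a ∈ maximalIdeal R ^ (j - r), ∃ b ∈ maximalIdeal R ^ (j - s),
      a * f + b * g = h by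
    obtain ⟨a, ha, b, hb, rfl⟩ := this t le_rfl
    rw [ini_add hx (mul_mem_pow_of_mem_sub ha hf) (mul_mem_pow_of_mem_sub hb hg),
      ini_mul_of_mem_sub hx ha hf, ini_mul_of_mem_sub hx hb hg]
    exact Ideal.mem_span_pair.mpr ⟨_, _, rfl⟩
  intro j
  induction j with
  | zero =>
    intro _
    obtain ⟨a, b, hab⟩ := Ideal.mem_span_pair.mp hfg
    exact ⟨a, by simp, b, by simp, hab⟩
  | succ j ih =>
    intro hj
    obtain ⟨a, ha, b, hb, rfl⟩ := ih (by omega)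
    have h0 := (ini_eq_zero_iff hx (Ideal.pow_le_pow_right (by omega) hh)).mpr
      (Ideal.pow_le_pow_right hj hh)
    rw [ini_add hx (mul_mem_pow_of_mem_sub ha hf) (mul_mem_pow_of_mem_sub hb hg),
      ini_mul_of_mem_sub hx ha hf, ini_mul_of_mem_sub hx hb hg] at h0
    obtain ⟨u, hu1, hu2⟩ := hK (if r ≤ j then ini x (j - r) a else 0)
      (-(if s ≤ j then ini x (j - s) b else 0)) (by linear_combination h0)
    have hF := ini_isHomogeneous (x := x) r f
    have hG := ini_isHomogeneous (x := x) s g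
    by_cases hrs : r + s ≤ j
    · rw [if_pos (by omega)] at hu1
      rw [if_pos (by omega)] at hu2
      have hu1' := congrArg (homogeneousComponent (j - r)) hu1
      have hu2' := congrArg (homogeneousComponent (j - s)) hu2
      rw [homogeneousComponent_mul_of_isHomogeneous hG, if_pos (by omega),
        homogeneousComponent_eq_self (ini_isHomogeneous _ _),
        show j - r - s = j - (r + s) by omega] at hu1'
      rw [homogeneousComponent_mul_of_isHomogeneous hF, if_pos (by omega), map_neg,
        homogeneousComponent_eq_self (ini_isHomogeneous _ _),
        show j - s - r = j - (r + s) by omega] at hu2'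
      obtain ⟨w, hw, hwu⟩ := exists_ini_eq hx (homogeneousComponent_isHomogeneous (j - (r + s)) u)
      rw [← hwu] at hu1' hu2'
      have e1 : s + (j - (r + s)) = j - r := by omega
      have e2 : r + (j - (r + s)) = j - s := by omega
      have hgw : g * w ∈ maximalIdeal R ^ (j - r) := by
        rw [← e1, pow_add]; exact Ideal.mul_mem_mul hg hw
      have hfw : f * w ∈ maximalIdeal R ^ (j - s) := by
        rw [← e2, pow_add]; exact Ideal.mul_mem_mul hf hw
      rw [← ini_mul hx hg hw, e1] at hu1'
      rw [← ini_mul hx hf hw, e2] at hu2'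
      refine ⟨a - g * w, ?_, b + f * w, ?_, by ring⟩
      · rw [show j + 1 - r = j - r + 1 by omega, ← ini_eq_zero_iff hx (sub_mem ha hgw),
          ini_sub hx ha hgw, hu1', sub_self]
      · rw [show j + 1 - s = j - s + 1 by omega, ← ini_eq_zero_iff hx (add_mem hb hfw),
          ini_add hx hb hfw, ← hu2', add_neg_cancel]
    -- For `j < r + s` a Koszul syzygy has no part in this degree, so both leading parts vanish and
    -- the orders rise with `a`, `b` unchanged.
    · refine ⟨a, mem_of_ite_ini_eq_zero hx ha ?_, b, mem_of_ite_ini_eq_zero hx hb ?_, rfl⟩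
      · split_ifs at hu1 ⊢ with hr
        swap; · rfl
        have hu1' := congrArg (homogeneousComponent (j - r)) hu1
        rwa [homogeneousComponent_mul_of_isHomogeneous hG, if_neg (by omega),
          homogeneousComponent_eq_self (ini_isHomogeneous _ _)] at hu1'
      · split_ifs at hu2 ⊢ with hr
        swap; · rfl
        have hu2' := congrArg (homogeneousComponent (j - s)) hu2
        rwa [homogeneousComponent_mul_of_isHomogeneous hF, if_neg (by omega), map_neg,
          homogeneousComponent_eq_self (ini_isHomogeneous _ _), neg_eq_zero] at hu2'

/-- Otherwise multiples of `f` could be subtracted for ever, giving `g ∈ (f) + m ^ n` for all `n`;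
Krull's intersection theorem in `R / (f)` then gives `g ∈ (f)`. -/
theorem exists_ini_sub_mul_notMem_span [IsNoetherianRing R] {f g : R} {r : ℕ}
    (hf : f ∈ maximalIdeal R ^ r) (hg : g ∉ Ideal.span {f}) :
    ∃ (c : R) (s : ℕ), g - c * f ∈ maximalIdeal R ^ s ∧
      ini x s (g - c * f) ∉ Ideal.span {ini x r f} := by
  by_contra! hcon
  apply hg
  have key : ∀ n, ∃ c, g - c * f ∈ maximalIdeal R ^ n := by
    intro n
    induction n with
    | zero => exact ⟨0, by simp⟩
    | succ n ih =>
      obtain ⟨c, hc⟩ := ih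
      obtain ⟨u, hu⟩ := Ideal.mem_span_singleton.mp (hcon c n hc)
      have hu' := congrArg (homogeneousComponent n) hu
      rw [homogeneousComponent_mul_of_isHomogeneous (ini_isHomogeneous _ _),
        homogeneousComponent_eq_self (ini_isHomogeneous _ _)] at hu'
      split_ifs at hu' with hrn
      · obtain ⟨w, hw, hwu⟩ := exists_ini_eq hx (homogeneousComponent_isHomogeneous (n - r) u)
        have hfw : f * w ∈ maximalIdeal R ^ n := by
          rw [← Nat.add_sub_cancel' hrn, pow_add]; exact Ideal.mul_mem_mul hf hw
        rw [← hwu, ← ini_mul hx hf hw, Nat.add_sub_cancel' hrn] at hu'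
        refine ⟨c + w, ?_⟩
        rw [show g - (c + w) * f = (g - c * f) - f * w by ring,
          ← ini_eq_zero_iff hx (sub_mem hc hfw), ini_sub hx hc hfw, hu', sub_self]
      · exact ⟨c, (ini_eq_zero_iff hx hc).mp hu'⟩
  rw [← Ideal.Quotient.eq_zero_iff_mem, ← Submodule.mem_bot R,
    ← Ideal.iInf_pow_smul_eq_bot_of_isLocalRing (M := R ⧸ Ideal.span {f}) (maximalIdeal R)
      (Ideal.IsPrime.ne_top'), Submodule.mem_iInf]
  intro n
  obtain ⟨c, hc⟩ := key n
  have : Ideal.Quotient.mk (Ideal.span {f}) g = (g - c * f) • (1 : R ⧸ Ideal.span {f}) := by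
    rw [Algebra.smul_def, mul_one, Ideal.Quotient.algebraMap_eq, Ideal.Quotient.eq]
    simpa using Ideal.mul_mem_left _ c (Ideal.mem_span_singleton_self f)
  rw [this]
  exact Submodule.smul_mem_smul hc trivial

omit hx in
lemma exists_mem_pow_notMem_pow_succ [IsNoetherianRing R] {f : R} (hf : f ≠ 0) :
    ∃ r, f ∈ maximalIdeal R ^ r ∧ f ∉ maximalIdeal R ^ (r + 1) := by
  by_contra! hcon
  apply hf
  rw [← Ideal.mem_bot, ← Ideal.iInf_pow_eq_bot_of_isLocalRing (maximalIdeal R)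
    (Ideal.IsPrime.ne_top'), Ideal.mem_iInf]
  intro n
  induction n with
  | zero => simp
  | succ n ih => exact hcon n ih

end Initial
end MvPolynomial

namespace CMGr

/-! ### Linkage of complete intersections of two elements. -/

section Linkage

variable {A : Type*} [CommRing A] [IsDomain A] {α β u v u' v' : A}

/-- If `(f₁, f₂) ⊆ (α, β)` are two complete intersections, the residual ideal `(f₁, f₂) : (α, β)`
is generated by `f₁`, `f₂` and the determinant of the matrix expressing `f₁, f₂` by `α, β`. -/
lemma mem_span_of_mul_mem_span_pair (hαβ : KoszulExact α β)
    (hf : KoszulExact (u * β - v * α) (u' * β - v' * α)) (h0 : α ≠ 0 ∨ β ≠ 0) {z : A}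
    (hzα : z * α ∈ Ideal.span {u * β - v * α, u' * β - v' * α})
    (hzβ : z * β ∈ Ideal.span {u * β - v * α, u' * β - v' * α}) :
    z ∈ Ideal.span {u * β - v * α, u' * β - v' * α, u * v' - u' * v} := by
  obtain ⟨p, q, hpq⟩ := Ideal.mem_span_pair.mp hzα
  obtain ⟨p', q', hpq'⟩ := Ideal.mem_span_pair.mp hzβ
  -- Comparing `β (z α)` with `α (z β)` gives a syzygy of the two generators; its Koszul coefficient
  -- `w` is the coefficient of the determinant in `z`.
  obtain ⟨w, hw1, hw2⟩ := hf (β * p - α * p') (α * q' - β * q) (by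
    linear_combination β * hpq - α * hpq')
  obtain ⟨s, hs1, hs2⟩ := hαβ (p' - w * v') (p - w * u') (by linear_combination -hw1)
  obtain ⟨t, ht1, ht2⟩ := hαβ (q' + w * v) (q + w * u) (by linear_combination hw2)
  have hz : z = w * (u * v' - u' * v) + s * (u * β - v * α) + t * (u' * β - v' * α) := by
    obtain hα | hβ := h0
    · apply mul_right_cancel₀ hα
      linear_combination -hpq + (u * β - v * α) * hs2 + (u' * β - v' * α) * ht2
    · apply mul_right_cancel₀ hβ
      linear_combination -hpq' + (u * β - v * α) * hs1 + (u' * β - v' * α) * ht1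
  rw [hz]
  refine Ideal.add_mem _ (Ideal.add_mem _ ?_ ?_) ?_
  · exact Ideal.mul_mem_left _ _ (Ideal.subset_span (by simp))
  · exact Ideal.mul_mem_left _ _ (Ideal.subset_span (by simp))
  · exact Ideal.mul_mem_left _ _ (Ideal.subset_span (by simp))

/-- Exactness of the Hilbert–Burch complex at the rank three term. Both `α` and `β` multiply the
determinant into the ideal of the other two minors, so multiplying the relation by them gives Koszul
syzygies, with coefficients `w'` and `w`. -/
lemma exists_of_syzygy (hf : KoszulExact (u * β - v * α) (u' * β - v' * α))
    (h0 : α ≠ 0 ∨ β ≠ 0) (hf2 : u' * β - v' * α ≠ 0) {X Y Z : A}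
    (h : X * (u * β - v * α) + Y * (u' * β - v' * α) + Z * (u * v' - u' * v) = 0) :
    ∃ w w', X = w * u' - w' * v' ∧ Y = w' * v - w * u ∧ Z = w' * β - w * α := by
  obtain ⟨w, h1, h2⟩ := hf (Z * v' + β * X) (Z * v - β * Y) (by linear_combination β * h)
  obtain ⟨w', h3, h4⟩ := hf (Z * u' + α * X) (Z * u - α * Y) (by linear_combination α * h)
  have hZ : Z = w' * β - w * α := by
    apply mul_right_cancel₀ hf2
    linear_combination β * h3 - α * h1
  refine ⟨w, w', ?_, ?_, hZ⟩
  · obtain hα | hβ := h0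
    · apply mul_left_cancel₀ hα
      linear_combination h3 - u' * hZ
    · apply mul_left_cancel₀ hβ
      linear_combination h1 - v' * hZ
  · obtain hα | hβ := h0
    · apply mul_left_cancel₀ hα
      linear_combination u * hZ - h4
    · apply mul_left_cancel₀ hβ
      linear_combination v * hZ - h2

lemma eq_zero_of_syzygy_eq_zero (hf1 : u' * β - v' * α ≠ 0) {w w' : A}
    (h1 : w * u' - w' * v' = 0) (h3 : w' * β - w * α = 0) : w = 0 ∧ w' = 0 := by
  constructor
  · apply (mul_eq_zero.mp _).resolve_right hf1
    linear_combination β * h1 + v' * h3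
  · apply (mul_eq_zero.mp _).resolve_right hf1
    linear_combination α * h1 + u' * h3

end Linkage

/-! ### Depth through vanishing of Ext, and the local Cohen–Macaulay criterion. -/

section LocalCM

open CategoryTheory Abelian IsLocalRing RingTheory.Sequence Pointwise

lemma subsingleton_ext_X₃ {B : Type u} [CommRing B] {S : ShortComplex (ModuleCat.{u} B)}
    (hS : S.ShortExact) (K : ModuleCat.{u} B) (i : ℕ) (h2 : Subsingleton (Ext K S.X₂ i))
    (h1 : Subsingleton (Ext K S.X₁ (i + 1))) : Subsingleton (Ext K S.X₃ i) := by
  have zero2 := AddCommGrpCat.isZero_of_iff_subsingleton.mpr h2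
  have zero1 := AddCommGrpCat.isZero_of_iff_subsingleton.mpr h1
  exact AddCommGrpCat.subsingleton_of_isZero <| ShortComplex.Exact.isZero_of_both_zeros
    (Ext.covariant_sequence_exact₃' K hS i (i + 1) rfl)
    (zero2.eq_zero_of_src _) (zero1.eq_zero_of_tgt _)

variable {B : Type u} [CommRing B]

lemma smul_top_lt_top [IsLocalRing B] {M : Type*} [AddCommGroup M] [Module B M] [Module.Finite B M]
    [Nontrivial M] : maximalIdeal B • (⊤ : Submodule B M) < ⊤ :=
  (Submodule.top_ne_ideal_smul_of_le_jacobson_annihilator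
    (IsLocalRing.maximalIdeal_le_jacobson _)).symm.lt_top

/-- Tensoring with a flat module preserves weak regularity; the result is needed for the free
modules `B`, `B²`, `B³`. -/
lemma subsingleton_ext_of_isWeaklyRegular [IsLocalRing B] [IsNoetherianRing B] (rs : List B)
    (hmem : ∀ r ∈ rs, r ∈ maximalIdeal B) (hreg : IsWeaklyRegular B rs)
    (M : Type u) [AddCommGroup M] [Module B M] [Module.Finite B M] [Module.Flat B M] [Nontrivial M]
    (i : ℕ) (hi : i < rs.length) :
    Subsingleton (Ext (ModuleCat.of B (B ⧸ maximalIdeal B)) (ModuleCat.of B M) i) := by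
  refine ModuleCat.subsingleton_ext_of_exists_isRegular (maximalIdeal B) _ ?_ (ModuleCat.of B M)
    smul_top_lt_top rs hmem ?_ i hi
  · change Module.support B (B ⧸ maximalIdeal B) ⊆ _
    rw [Module.support_eq_zeroLocus, Ideal.annihilator_quotient]
  · exact (IsLocalRing.isRegular_iff_isWeaklyRegular_of_subset_maximalIdeal hmem).mpr
      (((TensorProduct.rid B M).isWeaklyRegular_congr rs).mp (hreg.isWeaklyRegular_lTensor (M₂ := M)))

lemma KoszulExact.isWeaklyRegular [IsDomain B] {f g : B} (h : KoszulExact f g) (hf : f ≠ 0) :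
    IsWeaklyRegular B [f, g] := by
  refine .cons (fun a b hab ↦ mul_left_cancel₀ hf hab) ?_
  rw [isWeaklyRegular_singleton_iff]
  have e : f • (⊤ : Submodule B B) = Ideal.span {f} := by
    rw [← Submodule.ideal_span_singleton_smul, Ideal.smul_eq_mul, Ideal.mul_top]
  refine (isSMulRegular_quotient_iff_mem_of_smul_mem _ _).mpr ?_
  rw [e]
  intro z hz
  obtain ⟨c, hc⟩ := Ideal.mem_span_singleton.mp hz
  obtain ⟨w, -, rfl⟩ := h c z hc.symm
  exact Ideal.mul_mem_right _ _ (Ideal.mem_span_singleton_self f)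

/-- The two-step free resolution of the quotient by the maximal minors of a `3 × 2` matrix gives a
lower bound for the depth of the quotient. -/
lemma subsingleton_ext_quotient [IsDomain B] {α β u v u' v' : B}
    (hf : KoszulExact (u * β - v * α) (u' * β - v' * α))
    (h0 : α ≠ 0 ∨ β ≠ 0) (hf2 : u' * β - v' * α ≠ 0) (P : Ideal B)
    (hP : P = Ideal.span {u * β - v * α, u' * β - v' * α, u * v' - u' * v})
    (K : ModuleCat.{u} B) (n : ℕ)
    (hK1 : ∀ i < n, Subsingleton (Ext K (ModuleCat.of B B) i))
    (hK2 : ∀ i < n, Subsingleton (Ext K (ModuleCat.of B (B × B)) i))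
    (hK3 : ∀ i < n, Subsingleton (Ext K (ModuleCat.of B (B × B × B)) i)) (i : ℕ) (hi : i + 2 < n) :
    Subsingleton (Ext K (ModuleCat.of B (B ⧸ P)) i) := by
  have hmem1 : u * β - v * α ∈ P := by rw [hP]; exact Ideal.subset_span (by simp)
  have hmem2 : u' * β - v' * α ∈ P := by rw [hP]; exact Ideal.subset_span (by simp)
  have hmem3 : u * v' - u' * v ∈ P := by rw [hP]; exact Ideal.subset_span (by simp)
  let g1 : B →ₗ[B] P := LinearMap.toSpanSingleton B P ⟨_, hmem1⟩
  let g2 : B →ₗ[B] P := LinearMap.toSpanSingleton B P ⟨_, hmem2⟩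
  let g3 : B →ₗ[B] P := LinearMap.toSpanSingleton B P ⟨_, hmem3⟩
  let g : B × B × B →ₗ[B] P := g1.coprod (g2.coprod g3)
  have hg : ∀ X Y Z, (g (X, Y, Z) : B) =
      X * (u * β - v * α) + Y * (u' * β - v' * α) + Z * (u * v' - u' * v) := by
    intro X Y Z; simp [g, g1, g2, g3, add_assoc]
  let f : B × B →ₗ[B] B × B × B :=
    { toFun := fun w ↦ (w.1 * u' - w.2 * v', w.2 * v - w.1 * u, w.2 * β - w.1 * α)
      map_add' := fun a b ↦ by ext <;> simp <;> ring
      map_smul' := fun c a ↦ by ext <;> simp <;> ring }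
  let S : ShortComplex (ModuleCat.{u} B) := ShortComplex.mk (ModuleCat.ofHom f) (ModuleCat.ofHom g)
    (ModuleCat.hom_ext (LinearMap.ext fun w ↦ Subtype.ext (by
      change (g (_, _, _) : B) = 0
      rw [hg]; ring)))
  have hS : S.ShortExact :=
    { exact := by
        rw [ShortComplex.moduleCat_exact_iff]
        rintro ⟨X, Y, Z⟩ h
        have h' : (g (X, Y, Z) : B) = 0 := congrArg Subtype.val h
        rw [hg] at h'
        obtain ⟨w, w', rfl, rfl, rfl⟩ := exists_of_syzygy hf h0 hf2 h'
        exact ⟨(w, w'), rfl⟩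
      mono_f := by
        rw [ModuleCat.mono_iff_injective]
        refine (injective_iff_map_eq_zero f).mpr ?_
        rintro ⟨w, w'⟩ h
        have h1 := congrArg Prod.fst h
        have h3 := congrArg (fun t ↦ t.2.2) h
        obtain ⟨rfl, rfl⟩ := eq_zero_of_syzygy_eq_zero hf2 h1 h3
        rfl
      epi_g := by
        rw [ModuleCat.epi_iff_surjective]
        rintro ⟨y, hy⟩
        have hy' := hy
        rw [hP, Ideal.mem_span_insert] at hy'
        obtain ⟨X, z, hz, rfl⟩ := hy'
        obtain ⟨Y, Z, rfl⟩ := Ideal.mem_span_pair.mp hz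
        exact ⟨(X, Y, Z), Subtype.ext ((hg X Y Z).trans (add_assoc _ _ _))⟩ }
  let T : ShortComplex (ModuleCat.{u} B) := ShortComplex.mk (ModuleCat.ofHom P.subtype)
    (ModuleCat.ofHom P.mkQ) (by
      ext y
      exact (Submodule.Quotient.mk_eq_zero P).mpr y.2)
  have hT : T.ShortExact :=
    { exact := by
        rw [ShortComplex.moduleCat_exact_iff]
        intro y hy
        exact ⟨⟨y, (Submodule.Quotient.mk_eq_zero P).mp hy⟩, rfl⟩
      mono_f := by
        rw [ModuleCat.mono_iff_injective]
        exact P.subtype_injective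
      epi_g := by
        rw [ModuleCat.epi_iff_surjective]
        exact P.mkQ_surjective }
  -- Each of the two short exact sequences costs one Ext degree, whence the bound `i + 2 < n`.
  exact subsingleton_ext_X₃ hT K i (hK1 i (by omega))
    (subsingleton_ext_X₃ hS K (i + 1) (hK3 _ (by omega)) (hK2 _ (by omega)))

lemma depth_le_ringKrullDim {C : Type v} [CommRing C] [IsLocalRing C] [IsNoetherianRing C] :
    (depth C : WithBot ℕ∞) ≤ ringKrullDim C := by
  obtain ⟨N, hN⟩ := WithBot.ne_bot_iff_exists.mp (ringKrullDim_ne_bot (R := C))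
  rw [← hN, WithBot.coe_le_coe, depth, grade]
  refine iSup₂_le fun rs hrs ↦ ?_
  have h1 := ringKrullDim_add_length_eq_ringKrullDim_of_isRegular rs hrs.2
  have : Nontrivial (C ⧸ Ideal.ofList rs) := Ideal.Quotient.nontrivial_iff.mpr fun h ↦
    hrs.2.top_ne_smul (by rw [h, Ideal.smul_eq_mul, Ideal.mul_top])
  have h2 : ((rs.length : ℕ∞) : WithBot ℕ∞) ≤ (N : WithBot ℕ∞) := by
    rw [hN, ← h1]
    exact le_add_of_nonneg_left ringKrullDim_nonneg_of_nontrivial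
  exact WithBot.coe_le_coe.mp h2

/-- Two minors form a regular sequence in the kernel, so `dim C ≤ dim B - 2`; the resolution gives
`depth C ≥ dim B - 2`. -/
theorem isCohenMacaulayLocalRing_of_surjective [IsRegularLocalRing B] {C : Type v} [CommRing C]
    [IsLocalRing C] (φ : B →+* C) (hφ : Function.Surjective φ) {α β u v u' v' : B}
    (hf : KoszulExact (u * β - v * α) (u' * β - v' * α)) (h0 : α ≠ 0 ∨ β ≠ 0)
    (hf1 : u * β - v * α ≠ 0) (hf2 : u' * β - v' * α ≠ 0)
    (hker : RingHom.ker φ = Ideal.span {u * β - v * α, u' * β - v' * α, u * v' - u' * v}) :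
    IsCohenMacaulayLocalRing C := by
  have : IsDomain B := isDomain_of_isRegularLocalRing
  have : IsNoetherianRing C := isNoetherianRing_of_surjective _ _ φ hφ
  refine ⟨this, le_antisymm depth_le_ringKrullDim ?_⟩
  have hloc : IsLocalHom φ := .of_surjective φ hφ
  have hkerle : RingHom.ker φ ≤ maximalIdeal B := IsLocalRing.le_maximalIdeal (RingHom.ker_ne_top φ)
  have hmem1 : u * β - v * α ∈ RingHom.ker φ := by rw [hker]; exact Ideal.subset_span (by simp)
  have hmem2 : u' * β - v' * α ∈ RingHom.ker φ := by rw [hker]; exact Ideal.subset_span (by simp)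
  obtain ⟨rs, hlen, hrs, hreg⟩ := exists_isWeaklyRegular_ofList_eq_maximalIdeal B
  have hrsm : ∀ r ∈ rs, r ∈ maximalIdeal B := fun r hr ↦ by
    rw [← hrs]; exact Ideal.subset_span hr
  have hext := subsingleton_ext_of_isWeaklyRegular rs hrsm hreg
  have hE := subsingleton_ext_quotient hf h0 hf2 _ hker (ModuleCat.of B (B ⧸ maximalIdeal B))
    rs.length (hext B) (hext (B × B)) (hext (B × B × B))
  have hdim2 : ringKrullDim C + 2 ≤ rs.length := by
    have hreg2 : IsRegular B [u * β - v * α, u' * β - v' * α] :=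
      (IsLocalRing.isRegular_iff_isWeaklyRegular_of_subset_maximalIdeal (by
        simpa using ⟨hkerle hmem1, hkerle hmem2⟩)).mpr (hf.isWeaklyRegular hf1)
    rw [hlen, ← ringKrullDim_add_length_eq_ringKrullDim_of_isRegular _ hreg2]
    have hle : Ideal.ofList [u * β - v * α, u' * β - v' * α] ≤ RingHom.ker φ := by
      refine Ideal.span_le.mpr fun y hy ↦ ?_
      simp only [List.mem_cons, List.not_mem_nil, or_false, Set.mem_ofPred_eq] at hy
      obtain rfl | rfl := hy
      · exact hmem1
      · exact hmem2
    have := ringKrullDim_le_of_surjective (Ideal.Quotient.lift _ φ hle)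
      (Ideal.Quotient.lift_surjective_of_surjective _ _ hφ)
    exact add_le_add_left this _
  have hn2 : 2 ≤ rs.length := by
    have h1 : (0 : WithBot ℕ∞) + 2 ≤ rs.length :=
      le_trans (add_le_add_left ringKrullDim_nonneg_of_nontrivial _) hdim2
    rw [zero_add] at h1
    exact_mod_cast h1
  obtain ⟨n, hn⟩ := Nat.exists_eq_add_of_le' hn2
  have : Nontrivial (B ⧸ RingHom.ker φ) := Ideal.Quotient.nontrivial_iff.mpr (RingHom.ker_ne_top φ)
  obtain ⟨ss, hss, hssm, hssreg⟩ := ModuleCat.exists_isRegular_of_exists_subsingleton_ext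
    (maximalIdeal B) n (ModuleCat.of B (B ⧸ RingHom.ker φ)) smul_top_lt_top
    (ModuleCat.of B (B ⧸ maximalIdeal B)) (by
      change Module.support B (B ⧸ maximalIdeal B) = _
      rw [Module.support_eq_zeroLocus, Ideal.annihilator_quotient]) (fun i hi ↦ hE i (by omega))
  let _ : Algebra B C := φ.toAlgebra
  have hC : IsWeaklyRegular C ss :=
    (((Ideal.quotientKerAlgEquivOfSurjective (f := Algebra.ofId B C) hφ).toLinearEquiv
      ).isWeaklyRegular_congr ss).mp hssreg.1
  have hC' := (isWeaklyRegular_map_algebraMap_iff C C ss).mpr hC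
  have hmemC : ∀ r ∈ ss.map (algebraMap B C), r ∈ maximalIdeal C := by
    intro r hr
    obtain ⟨b, hb, rfl⟩ := List.mem_map.mp hr
    exact (map_mem_nonunits_iff φ b).mpr (hssm b hb)
  have hdepth : ((ss.map (algebraMap B C)).length : ℕ∞) ≤ depth C := by
    rw [depth, grade]
    exact le_iSup₂_of_le (ss.map (algebraMap B C)) ⟨hmemC,
      (IsLocalRing.isRegular_iff_isWeaklyRegular_of_subset_maximalIdeal hmemC).mpr hC'⟩ le_rfl
  rw [List.length_map, hss] at hdepth
  refine le_trans ?_ (WithBot.coe_le_coe.mpr hdepth)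
  rw [hn] at hdim2
  push_cast at hdim2
  exact ENat.WithBot.add_le_add_natCast_right_iff.mp hdim2

end LocalCM

end CMGr

namespace CMGr

/-! ### The Hilbert–Burch theorem for three generators. -/

section HilbertBurch

open CategoryTheory IsLocalRing RingTheory.Sequence Pointwise

variable {R : Type u} [CommRing R]

/-- The cross product of the Koszul syzygies `(-g₂, g₁, 0)` and `(-g₃, 0, g₁)` is `g₁ (g₁, g₂, g₃)`.
Expressing them through the two given syzygies multiplies the cross product of the latter by the
determinant `d` of the coefficients. -/
lemma exists_mul_eq_mul_minor {g₁ g₂ g₃ a₁ a₂ a₃ b₁ b₂ b₃ : R}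
    (hsyz : ∀ c₁ c₂ c₃, c₁ * g₁ + c₂ * g₂ + c₃ * g₃ = 0 →
      ∃ s t, c₁ = s * a₁ + t * b₁ ∧ c₂ = s * a₂ + t * b₂ ∧ c₃ = s * a₃ + t * b₃) :
    ∃ d, g₁ * g₁ = d * (a₂ * b₃ - a₃ * b₂) ∧ g₁ * g₂ = d * (a₃ * b₁ - a₁ * b₃) ∧
      g₁ * g₃ = d * (a₁ * b₂ - a₂ * b₁) := by
  obtain ⟨s, t, h1, h2, h3⟩ := hsyz (-g₂) g₁ 0 (by ring)
  obtain ⟨s', t', k1, k2, k3⟩ := hsyz (-g₃) 0 g₁ (by ring)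
  refine ⟨s * t' - t * s', ?_, ?_, ?_⟩
  · linear_combination g₁ * h2 + (s * a₂ + t * b₂) * k3 - (s * a₃ + t * b₃) * k2
  · linear_combination (-g₁) * h1 - (s * a₁ + t * b₁) * k3 + (s' * a₁ + t' * b₁) * h3
  · linear_combination (-g₁) * k1 - (s' * a₁ + t' * b₁) * h2 + (s * a₁ + t * b₁) * k2

/-- The Hilbert–Burch theorem for three generators: a complete set of syzygies with two elements
determines the generators as its maximal minors, up to a common factor. -/
lemma exists_mul_minor_eq [IsDomain R] {g₁ g₂ g₃ a₁ a₂ a₃ b₁ b₂ b₃ x y : R}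
    (hsyz : ∀ c₁ c₂ c₃, c₁ * g₁ + c₂ * g₂ + c₃ * g₃ = 0 →
      ∃ s t, c₁ = s * a₁ + t * b₁ ∧ c₂ = s * a₂ + t * b₂ ∧ c₃ = s * a₃ + t * b₃)
    (hx : x ∈ Ideal.span {g₁, g₂, g₃}) (hy : y ∈ Ideal.span {g₁, g₂, g₃}) (hx0 : x ≠ 0)
    (hxy : ∀ z, x ∣ y * z → x ∣ z) :
    ∃ h, g₁ = h * (a₂ * b₃ - a₃ * b₂) ∧ g₂ = h * (a₃ * b₁ - a₁ * b₃) ∧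
      g₃ = h * (a₁ * b₂ - a₂ * b₁) := by
  obtain ⟨d₁, h11, h12, h13⟩ := exists_mul_eq_mul_minor hsyz
  obtain ⟨d₂, h22, h23, h21⟩ := exists_mul_eq_mul_minor
    (g₁ := g₂) (g₂ := g₃) (g₃ := g₁) (a₁ := a₂) (a₂ := a₃) (a₃ := a₁)
    (b₁ := b₂) (b₂ := b₃) (b₃ := b₁) fun c₁ c₂ c₃ h ↦ by
      obtain ⟨s, t, k1, k2, k3⟩ := hsyz c₃ c₁ c₂ (by linear_combination h)
      exact ⟨s, t, k2, k3, k1⟩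
  obtain ⟨d₃, h33, h31, h32⟩ := exists_mul_eq_mul_minor
    (g₁ := g₃) (g₂ := g₁) (g₃ := g₂) (a₁ := a₃) (a₂ := a₁) (a₃ := a₂)
    (b₁ := b₃) (b₂ := b₁) (b₃ := b₂) fun c₁ c₂ c₃ h ↦ by
      obtain ⟨s, t, k1, k2, k3⟩ := hsyz c₂ c₃ c₁ (by linear_combination h)
      exact ⟨s, t, k3, k1, k2⟩
  have key : ∀ z ∈ Ideal.span {g₁, g₂, g₃}, ∃ d, z * g₁ = d * (a₂ * b₃ - a₃ * b₂) ∧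
      z * g₂ = d * (a₃ * b₁ - a₁ * b₃) ∧ z * g₃ = d * (a₁ * b₂ - a₂ * b₁) := by
    intro z hz
    obtain ⟨z₁, w, hw, rfl⟩ := Ideal.mem_span_insert.mp hz
    obtain ⟨z₂, z₃, rfl⟩ := Ideal.mem_span_pair.mp hw
    refine ⟨z₁ * d₁ + z₂ * d₂ + z₃ * d₃, ?_, ?_, ?_⟩
    · linear_combination z₁ * h11 + z₂ * h21 + z₃ * h31
    · linear_combination z₁ * h12 + z₂ * h22 + z₃ * h32
    · linear_combination z₁ * h13 + z₂ * h23 + z₃ * h33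
  obtain ⟨dx, x1, x2, x3⟩ := key x hx
  obtain ⟨dy, y1, y2, y3⟩ := key y hy
  -- If this failed, all minors would vanish, hence all `gᵢ`, hence `x`.
  have hd : x * dy = y * dx := by
    by_contra hne
    have hne' : x * dy - y * dx ≠ 0 := sub_ne_zero.mpr hne
    have m1 : a₂ * b₃ - a₃ * b₂ = 0 := (mul_eq_zero.mp (by
      linear_combination y * x1 - x * y1 :
        (x * dy - y * dx) * (a₂ * b₃ - a₃ * b₂) = 0)).resolve_left hne'
    have m2 : a₃ * b₁ - a₁ * b₃ = 0 := (mul_eq_zero.mp (by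
      linear_combination y * x2 - x * y2 :
        (x * dy - y * dx) * (a₃ * b₁ - a₁ * b₃) = 0)).resolve_left hne'
    have m3 : a₁ * b₂ - a₂ * b₁ = 0 := (mul_eq_zero.mp (by
      linear_combination y * x3 - x * y3 :
        (x * dy - y * dx) * (a₁ * b₂ - a₂ * b₁) = 0)).resolve_left hne'
    rw [m1, mul_zero, mul_eq_zero] at x1
    rw [m2, mul_zero, mul_eq_zero] at x2
    rw [m3, mul_zero, mul_eq_zero] at x3
    have := x1.resolve_left hx0
    have := x2.resolve_left hx0
    have := x3.resolve_left hx0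
    subst_vars
    simp at hx
    exact hx0 hx
  obtain ⟨h, rfl⟩ := hxy dx (Dvd.intro _ hd)
  have e1 : g₁ = h * (a₂ * b₃ - a₃ * b₂) := mul_left_cancel₀ hx0 (by rw [x1]; ring)
  have e2 : g₂ = h * (a₃ * b₁ - a₁ * b₃) := mul_left_cancel₀ hx0 (by rw [x2]; ring)
  have e3 : g₃ = h * (a₁ * b₂ - a₂ * b₁) := mul_left_cancel₀ hx0 (by rw [x3]; ring)
  exact ⟨h, e1, e2, e3⟩

lemma length_le_height [IsNoetherianRing R] {I : Ideal R} (rs : List R) (hmem : ∀ r ∈ rs, r ∈ I)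
    (hreg : IsWeaklyRegular R rs) : (rs.length : ℕ∞) ≤ I.height := by
  rw [Ideal.height_eq_inf_minimalPrimes]
  refine le_iInf₂ fun p hp ↦ ?_
  have : p.IsPrime := hp.1.1
  have h1 := hreg.isRegular_of_isLocalization_of_mem (Localization.AtPrime p) p
    (fun r hr ↦ hp.1.2 (hmem r hr))
  have h2 := ringKrullDim_add_length_eq_ringKrullDim_of_isRegular _ h1
  rw [IsLocalization.AtPrime.ringKrullDim_eq_height p (Localization.AtPrime p), List.length_map] at h2
  have : Nontrivial (Localization.AtPrime p ⧸
      Ideal.ofList (rs.map (algebraMap R (Localization.AtPrime p)))) :=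
    Ideal.Quotient.nontrivial_iff.mpr fun h ↦
      h1.top_ne_smul (by rw [h, Ideal.smul_eq_mul, Ideal.mul_top])
  rw [← WithBot.coe_le_coe, ← h2]
  exact le_add_of_nonneg_left ringKrullDim_nonneg_of_nontrivial

lemma grade_le_height [IsNoetherianRing R] (I : Ideal R) : grade I ≤ I.height :=
  iSup₂_le fun rs hrs ↦ length_le_height rs hrs.1 hrs.2.1

lemma height_span_singleton_le_one [IsNoetherianRing R] {h : R} (hh : ¬ IsUnit h) :
    (Ideal.span {h}).height ≤ 1 := by
  refine (Ideal.height_le_spanFinrank _ (by rwa [Ne, Ideal.span_singleton_eq_top])).trans ?_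
  have := Submodule.spanFinrank_span_le_ncard_of_finite (R := R) (Set.finite_singleton h)
  rw [Set.ncard_singleton] at this
  exact_mod_cast this

lemma shortExact_subtype_mkQ (I : Ideal R) :
    (ShortComplex.mk (ModuleCat.ofHom I.subtype) (ModuleCat.ofHom I.mkQ)
      (ModuleCat.hom_ext (LinearMap.ext fun y ↦ (Submodule.Quotient.mk_eq_zero I).mpr y.2))
        ).ShortExact :=
  { exact := by
      rw [ShortComplex.moduleCat_exact_iff]
      intro y hy
      exact ⟨⟨y, (Submodule.Quotient.mk_eq_zero I).mp hy⟩, rfl⟩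
    mono_f := by
      rw [ModuleCat.mono_iff_injective]
      exact I.subtype_injective
    epi_g := by
      rw [ModuleCat.epi_iff_surjective]
      exact I.mkQ_surjective }

lemma shortExact_ker {M N : Type u} [AddCommGroup M] [Module R M] [AddCommGroup N] [Module R N]
    (g : M →ₗ[R] N) (hg : Function.Surjective g) :
    (ShortComplex.mk (ModuleCat.ofHom (LinearMap.ker g).subtype) (ModuleCat.ofHom g)
      (ModuleCat.hom_ext (LinearMap.ext fun y ↦ y.2))).ShortExact :=
  { exact := by
      rw [ShortComplex.moduleCat_exact_iff]
      intro y hy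
      exact ⟨⟨y, hy⟩, rfl⟩
    mono_f := by
      rw [ModuleCat.mono_iff_injective]
      exact (LinearMap.ker g).subtype_injective
    epi_g := by
      rw [ModuleCat.epi_iff_surjective]
      exact hg }

lemma free_of_hasProjectiveDimensionLE_zero [IsLocalRing R] (M : Type u) [AddCommGroup M]
    [Module R M] [Module.Finite R M] [HasProjectiveDimensionLT (ModuleCat.of R M) 1] :
    Module.Free R M := by
  have h : Projective (ModuleCat.of R M) := projective_iff_hasProjectiveDimensionLT_one.mpr ‹_›
  have h' : Module.Projective R M := (IsProjective.iff_projective M).mpr h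
  exact Module.free_of_flat_of_isLocalRing

/-- Grade at most one would give `R / I` projective dimension at most one, making `I` free; a free
ideal has rank at most one, hence at most one minimal generator. -/
lemma one_lt_grade_of_isPerfectIdeal [IsLocalRing R] [IsNoetherianRing R] {I : Ideal R}
    (hI : IsPerfectIdeal I) (hgen : 1 < I.spanFinrank) : 1 < grade I := by
  by_contra! hle
  have h1 : HasProjectiveDimensionLE (ModuleCat.of R (R ⧸ I)) 1 := by
    rw [← projectiveDimension_le_iff, hI.2]
    exact WithBot.coe_le_coe.mpr hle
  have h2 : HasProjectiveDimensionLT (ModuleCat.of R I) 1 :=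
    ((shortExact_subtype_mkQ I).hasProjectiveDimensionLT_X₃_iff 0
      (inferInstanceAs (Projective (ModuleCat.of R R)))).mp h1
  have h3 : Module.Free R I := free_of_hasProjectiveDimensionLE_zero I
  have h4 := Module.finrank_eq_spanFinrank_of_free (R := R) (M := I)
  rw [Submodule.spanFinrank_top] at h4
  have h5 := Submodule.finrank_le (R := R) (M := R) I
  rw [Module.finrank_self] at h5
  omega

lemma exists_regular_pair_of_one_lt_grade [IsDomain R] {I : Ideal R} (h : 1 < grade I) :
    ∃ x ∈ I, ∃ y ∈ I, x ≠ 0 ∧ ∀ z, x ∣ y * z → x ∣ z := by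
  rw [grade, lt_iSup_iff] at h
  obtain ⟨rs, h⟩ := h
  rw [lt_iSup_iff] at h
  obtain ⟨⟨hmem, hreg⟩, hlen⟩ := h
  match rs, hlen, hmem, hreg with
  | x :: y :: rs, _, hmem, hreg =>
    have h1 := (isWeaklyRegular_cons_iff R x _).mp hreg.1
    have h2 := ((isWeaklyRegular_cons_iff _ y _).mp h1.2).1
    have e : x • (⊤ : Submodule R R) = Ideal.span {x} := by
      rw [← Submodule.ideal_span_singleton_smul, Ideal.smul_eq_mul, Ideal.mul_top]
    refine ⟨x, hmem x (by simp), y, hmem y (by simp), ?_, fun z hz ↦ ?_⟩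
    · rintro rfl
      exact one_ne_zero (h1.1 (by simp : (0 : R) • (1 : R) = (0 : R) • (0 : R)))
    · have := (isSMulRegular_quotient_iff_mem_of_smul_mem _ _).mp h2 z
      rw [e, Ideal.mem_span_singleton, Ideal.mem_span_singleton] at this
      exact this hz
  | [x], hlen, _, _ => simp at hlen
  | [], hlen, _, _ => simp at hlen

/-- A perfect ideal of height two with three generators in a regular local ring is generated by
the maximal minors of a `3 × 2` matrix. -/
theorem exists_eq_span_minors [IsRegularLocalRing R] {I : Ideal R} (hheight : I.height = 2)
    (hI : IsPerfectIdeal I) (hgen : I.spanFinrank = 3) :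
    ∃ a₁ a₂ a₃ b₁ b₂ b₃, I = Ideal.span {a₂ * b₃ - a₃ * b₂, a₃ * b₁ - a₁ * b₃,
      a₁ * b₂ - a₂ * b₁} := by
  classical
  have : IsDomain R := isDomain_of_isRegularLocalRing
  obtain ⟨s, hs, hspan⟩ := Submodule.FG.exists_span_finset_card_eq_spanFinrank
    I.fg_of_isNoetherianRing
  rw [hgen, Finset.card_eq_three] at hs
  obtain ⟨g₁, g₂, g₃, -, -, -, rfl⟩ := hs
  have hIs : I = Ideal.span {g₁, g₂, g₃} := by
    rw [← hspan]; simp [Ideal.span]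
  have m1 : g₁ ∈ I := by rw [hIs]; exact Ideal.subset_span (by simp)
  have m2 : g₂ ∈ I := by rw [hIs]; exact Ideal.subset_span (by simp)
  have m3 : g₃ ∈ I := by rw [hIs]; exact Ideal.subset_span (by simp)
  have hne : Nontrivial I := Submodule.nontrivial_iff_ne_bot.mpr fun h ↦ by
    rw [h, Submodule.spanFinrank_bot] at hgen; omega
  let g : R × R × R →ₗ[R] I := (LinearMap.toSpanSingleton R I ⟨_, m1⟩).coprod
    ((LinearMap.toSpanSingleton R I ⟨_, m2⟩).coprod (LinearMap.toSpanSingleton R I ⟨_, m3⟩))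
  have hg : ∀ X Y Z, (g (X, Y, Z) : R) = X * g₁ + Y * g₂ + Z * g₃ := by
    intro X Y Z; simp [g, add_assoc]
  have hgs : Function.Surjective g := by
    rintro ⟨y, hy⟩
    have hy' := hy
    rw [hIs, Ideal.mem_span_insert] at hy'
    obtain ⟨X, z, hz, rfl⟩ := hy'
    obtain ⟨Y, Z, rfl⟩ := Ideal.mem_span_pair.mp hz
    exact ⟨(X, Y, Z), Subtype.ext ((hg X Y Z).trans (add_assoc _ _ _))⟩
  -- Projective dimension at most two makes the syzygy module of three generators free, of rank 3 -
  -- 1 = 2.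
  have h1 : HasProjectiveDimensionLE (ModuleCat.of R (R ⧸ I)) 2 := by
    rw [← projectiveDimension_le_iff, hI.2]
    exact WithBot.coe_le_coe.mpr ((grade_le_height I).trans hheight.le)
  have h2 : HasProjectiveDimensionLT (ModuleCat.of R I) 2 :=
    ((shortExact_subtype_mkQ I).hasProjectiveDimensionLT_X₃_iff 1
      (inferInstanceAs (Projective (ModuleCat.of R R)))).mp h1
  have h3 : HasProjectiveDimensionLT (ModuleCat.of R (LinearMap.ker g)) 1 :=
    ((shortExact_ker g hgs).hasProjectiveDimensionLT_X₃_iff 0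
      ((IsProjective.iff_projective (R × R × R)).mp inferInstance)).mp h2
  have h4 : Module.Free R (LinearMap.ker g) := free_of_hasProjectiveDimensionLE_zero _
  have h5 : Module.finrank R (LinearMap.ker g) = 2 := by
    have e1 := Submodule.finrank_quotient_add_finrank (LinearMap.ker g)
    rw [(LinearMap.quotKerEquivOfSurjective g hgs).finrank_eq] at e1
    have e2 := Submodule.finrank_le (R := R) (M := R) I
    rw [Module.finrank_self] at e2
    have e3 : 0 < Module.finrank R I := Module.finrank_pos
    simp at e1
    omega
  let bas := Module.finBasisOfFinrankEq R (LinearMap.ker g) h5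
  obtain ⟨⟨a₁, a₂, a₃⟩, ha⟩ : ∃ a, a = (bas 0 : R × R × R) := ⟨_, rfl⟩
  obtain ⟨⟨b₁, b₂, b₃⟩, hb⟩ : ∃ b, b = (bas 1 : R × R × R) := ⟨_, rfl⟩
  have hsyz : ∀ c₁ c₂ c₃, c₁ * g₁ + c₂ * g₂ + c₃ * g₃ = 0 →
      ∃ s t, c₁ = s * a₁ + t * b₁ ∧ c₂ = s * a₂ + t * b₂ ∧ c₃ = s * a₃ + t * b₃ := by
    intro c₁ c₂ c₃ hc
    have hmem : (c₁, c₂, c₃) ∈ LinearMap.ker g := Subtype.ext ((hg _ _ _).trans hc)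
    have hsum := bas.sum_repr ⟨_, hmem⟩
    rw [Fin.sum_univ_two] at hsum
    have hsum' := congrArg Subtype.val hsum
    simp only [Submodule.coe_add, Submodule.coe_smul, ← ha, ← hb, Prod.smul_mk, Prod.mk_add_mk,
      Prod.mk.injEq, smul_eq_mul] at hsum'
    exact ⟨_, _, hsum'.1.symm, hsum'.2.1.symm, hsum'.2.2.symm⟩
  obtain ⟨x, hx, y, hy, hx0, hxy⟩ :=
    exists_regular_pair_of_one_lt_grade (one_lt_grade_of_isPerfectIdeal hI (by omega))
  rw [hIs] at hx hy
  obtain ⟨h, e1, e2, e3⟩ := exists_mul_minor_eq hsyz hx hy hx0 hxy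
  -- The common factor `h` need not be known to be a unit: it is absorbed into the first column.
  refine ⟨h * a₁, h * a₂, h * a₃, b₁, b₂, b₃, ?_⟩
  rw [hIs, e1, e2, e3]
  ring_nf

end HilbertBurch
end CMGr

namespace CMGr

/-! ### From the local criterion to all maximal ideals. -/

section Globalize

open IsLocalization

lemma KoszulExact.localization {A : Type*} [CommRing A] [IsDomain A] {f g : A} (h : KoszulExact f g)
    (p : Ideal A) [p.IsPrime] :
    KoszulExact (algebraMap A (Localization.AtPrime p) f) (algebraMap A _ g) := by
  intro P Q hPQ
  obtain ⟨a, s, rfl⟩ := exists_mk'_eq p.primeCompl P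
  obtain ⟨b, t, rfl⟩ := exists_mk'_eq p.primeCompl Q
  have hinj : Function.Injective (algebraMap A (Localization.AtPrime p)) :=
    IsLocalization.injective _ p.primeCompl_le_nonZeroDivisors
  have h1 : f * (a * t) = g * (b * s) := by
    apply hinj
    have hs := mk'_spec (Localization.AtPrime p) a s
    have ht := mk'_spec (Localization.AtPrime p) b t
    simp only [map_mul]
    rw [← hs, ← ht]
    linear_combination (algebraMap A (Localization.AtPrime p) s) *
      (algebraMap A (Localization.AtPrime p) t) * hPQ
  obtain ⟨w, hw1, hw2⟩ := h _ _ h1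
  refine ⟨mk' _ w (s * t), ?_, ?_⟩
  · rw [mul_mk'_eq_mk'_of_mul, mk'_eq_iff_eq, ← hw1, Submonoid.coe_mul]
    congr 1; ring
  · rw [mul_mk'_eq_mk'_of_mul, mk'_eq_iff_eq, ← hw2, Submonoid.coe_mul]
    congr 1; ring

theorem isCohenMacaulayRing_of_surjective {A : Type u} [CommRing A] [IsDomain A] [IsRegularRing A]
    {C : Type v} [CommRing C] (φ : A →+* C) (hφ : Function.Surjective φ) {α β u v u' v' : A}
    (hf : KoszulExact (u * β - v * α) (u' * β - v' * α)) (h0 : α ≠ 0 ∨ β ≠ 0)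
    (hf1 : u * β - v * α ≠ 0) (hf2 : u' * β - v' * α ≠ 0)
    (hker : RingHom.ker φ = Ideal.span {u * β - v * α, u' * β - v' * α, u * v' - u' * v}) :
    IsCohenMacaulayRing C := by
  refine ⟨isNoetherianRing_of_surjective _ _ φ hφ, fun Q hQ ↦ ?_⟩
  have hQp : Q.IsPrime := hQ.isPrime
  let p : Ideal A := Q.comap φ
  let ψ := Localization.localRingHom p Q φ rfl
  have hinj : Function.Injective (algebraMap A (Localization.AtPrime p)) :=
    IsLocalization.injective _ p.primeCompl_le_nonZeroDivisors
  have hψ : Function.Surjective ψ := by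
    intro y
    obtain ⟨c, s, rfl⟩ := exists_mk'_eq Q.primeCompl y
    obtain ⟨a, rfl⟩ := hφ c
    obtain ⟨t, ht⟩ := hφ s
    refine ⟨mk' _ a (⟨t, fun h ↦ s.2 (by rw [← ht]; exact h)⟩ : p.primeCompl), ?_⟩
    rw [Localization.localRingHom_mk']
    congr 1
    exact Subtype.ext ht
  have hkerψ : RingHom.ker ψ = (RingHom.ker φ).map (algebraMap A (Localization.AtPrime p)) := by
    apply le_antisymm
    · intro y hy
      obtain ⟨a, s, rfl⟩ := exists_mk'_eq p.primeCompl y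
      rw [RingHom.mem_ker, Localization.localRingHom_mk', mk'_eq_zero_iff] at hy
      obtain ⟨c, hc⟩ := hy
      obtain ⟨c', hc'⟩ := hφ c
      have hcp : c' ∈ p.primeCompl := fun h ↦ c.2 (by rw [← hc']; exact h)
      have h1 : c' * a ∈ RingHom.ker φ := by rw [RingHom.mem_ker, map_mul, hc', hc]
      have h2 := Ideal.mem_map_of_mem (algebraMap A (Localization.AtPrime p)) h1
      rw [map_mul, Ideal.unit_mul_mem_iff_mem _ (map_units _ (⟨c', hcp⟩ : p.primeCompl)),
        ← mk'_spec (Localization.AtPrime p) a s, Ideal.mul_unit_mem_iff_mem _ (map_units _ s)] at h2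
      exact h2
    · rw [Ideal.map_le_iff_le_comap]
      intro a ha
      rw [Ideal.mem_comap, RingHom.mem_ker, Localization.localRingHom_to_map,
        (RingHom.mem_ker.mp ha), map_zero]
  have hK := hf.localization p
  simp only [map_sub, map_mul] at hK
  refine isCohenMacaulayLocalRing_of_surjective ψ hψ hK ?_ ?_ ?_ ?_
  · exact h0.imp (fun h ↦ (map_ne_zero_iff _ hinj).mpr h) fun h ↦ (map_ne_zero_iff _ hinj).mpr h
  · simpa only [map_sub, map_mul] using (map_ne_zero_iff _ hinj).mpr hf1
  · simpa only [map_sub, map_mul] using (map_ne_zero_iff _ hinj).mpr hf2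
  · rw [hkerψ, hker, Ideal.map_span]
    simp only [Set.image_insert_eq, Set.image_singleton, map_sub, map_mul]

end Globalize

end CMGr

namespace MvPolynomial
open IsLocalRing CMGr

/-! ### The associated graded ring as a quotient of a polynomial ring. -/

section AssociatedGraded

variable {R : Type u} [CommRing R] [IsLocalRing R] {S : Type v} [CommRing S] [IsLocalRing S]
  {ι : Type*} (x : ι → R) (π : R →+* S) (hx : IsRegularParameters x) (hπ : Function.Surjective π)

lemma map_mem_maximalIdeal_of_surjective {π : R →+* S} (hπ : Function.Surjective π) {r : R}
    (hr : r ∈ maximalIdeal R) : π r ∈ maximalIdeal S := by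
  rw [← map_maximalIdeal_of_surjective π hπ]
  exact Ideal.mem_map_of_mem _ hr

/-- The homomorphism from a polynomial ring onto the Rees algebra of the maximal ideal. -/
noncomputable def toRees (hπx : ∀ i, π (x i) ∈ maximalIdeal S) :
    MvPolynomial ι R →+* reesAlgebra (maximalIdeal S) :=
  eval₂Hom ((algebraMap S (reesAlgebra (maximalIdeal S))).comp π) fun i ↦
    ⟨Polynomial.monomial 1 (π (x i)), reesAlgebra.monomial_mem.mpr (by simpa using hπx i)⟩

omit [IsLocalRing R] in
lemma coeff_toRees (hπx : ∀ i, π (x i) ∈ maximalIdeal S) (F : MvPolynomial ι R) (r : ℕ) :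
    (toRees x π hπx F : S[X]).coeff r = π (eval x (homogeneousComponent r F)) := by
  induction F using MvPolynomial.induction_on generalizing r with
  | C c =>
    rw [toRees, coe_eval₂Hom, eval₂_C, homogeneousComponent_of_mem (isHomogeneous_C ι c)]
    change (algebraMap S S[X] (π c)).coeff r = _
    rw [Polynomial.algebraMap_apply, Algebra.algebraMap_self_apply, Polynomial.coeff_C]
    split_ifs <;> simp
  | add p q hp hq =>
    rw [map_add, Subalgebra.coe_add, Polynomial.coeff_add, hp, hq, map_add, map_add, map_add]
  | mul_X p i hp =>
    have h1 : (toRees x π hπx (X i) : S[X]) = Polynomial.X * Polynomial.C (π (x i)) := by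
      rw [toRees, coe_eval₂Hom, eval₂_X, ← Polynomial.monomial_one_one_eq_X, Polynomial.monomial_mul_C,
        one_mul]
    rw [map_mul, Subalgebra.coe_mul, h1, mul_comm p, 
      homogeneousComponent_mul_of_isHomogeneous (isHomogeneous_X R i), mul_comm, mul_assoc]
    cases r with
    | zero => simp
    | succ r =>
      rw [Polynomial.coeff_X_mul, Polynomial.coeff_C_mul, hp, if_pos (by omega)]
      simp

lemma mem_maximalIdeal_pow_iff_exists {π : R →+* S} (hπ : Function.Surjective π) {r : ℕ} {s : S} :
    s ∈ maximalIdeal S ^ r ↔ ∃ f ∈ maximalIdeal R ^ r, π f = s := by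
  rw [← map_maximalIdeal_of_surjective π hπ, ← Ideal.map_pow,
    Ideal.mem_map_iff_of_surjective π hπ]

include hx hπ in
lemma toRees_surjective (hπx : ∀ i, π (x i) ∈ maximalIdeal S) :
    Function.Surjective (toRees x π hπx) := by
  rintro ⟨p, hp⟩
  have h1 : ∀ r, ∃ F : MvPolynomial ι R, F.IsHomogeneous r ∧ π (eval x F) = p.coeff r := fun r ↦ by
    obtain ⟨f, hf, hfp⟩ := (mem_maximalIdeal_pow_iff_exists hπ).mp (hp r)
    obtain ⟨F, hF, rfl⟩ := hx.exists_eval_eq hf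
    exact ⟨F, hF, hfp⟩
  choose F hF hFp using h1
  refine ⟨∑ r ∈ Finset.range (p.natDegree + 1), F r, Subtype.ext (Polynomial.ext fun r ↦ ?_)⟩
  rw [coeff_toRees, map_sum]
  have h2 : ∀ i ∈ Finset.range (p.natDegree + 1),
      homogeneousComponent r (F i) = if i = r then F i else 0 := fun i _ ↦ by
    rw [homogeneousComponent_of_mem (hF i)]
    simp only [eq_comm]
  rw [Finset.sum_congr rfl h2, Finset.sum_ite_eq']
  split_ifs with hr
  · exact hFp r
  · rw [map_zero, map_zero]
    refine (Polynomial.coeff_eq_zero_of_natDegree_lt (p := p) ?_).symm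
    rw [Finset.mem_range] at hr; omega

include hx hπ in
/-- The associated graded ring of a quotient of a local ring with quasi-regular generators of the
maximal ideal is a quotient of a polynomial ring by the ideal of initial forms. -/
theorem exists_surjective_associatedGradedRing :
    ∃ Ψ : MvPolynomial ι (ResidueField R) →+* AssociatedGradedRing (maximalIdeal S),
      Function.Surjective Ψ ∧ ∀ G, Ψ G = 0 ↔ ∀ r, ∃ f ∈ RingHom.ker π, f ∈ maximalIdeal R ^ r ∧
        ini x r f = homogeneousComponent r G := by
  have hπx : ∀ i, π (x i) ∈ maximalIdeal S := fun i ↦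
    map_mem_maximalIdeal_of_surjective hπ (by rw [← hx.span_eq]; exact Ideal.subset_span ⟨i, rfl⟩)
  let Θ : MvPolynomial ι R →+* AssociatedGradedRing (maximalIdeal S) :=
    (Ideal.Quotient.mk _).comp (toRees x π hπx)
  have hΘ : ∀ F, Θ F = 0 ↔ ∀ r, π (eval x (homogeneousComponent r F)) ∈ maximalIdeal S ^ (r + 1) := by
    intro F
    change Ideal.Quotient.mk _ (toRees x π hπx F) = 0 ↔ _
    rw [Ideal.Quotient.eq_zero_iff_mem]
    change (∀ i, (toRees x π hπx F : S[X]).coeff i ∈ maximalIdeal S ^ (i + 1)) ↔ _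
    simp only [coeff_toRees]
  have hres := map_surjective (σ := ι) (residue R) residue_surjective
  -- Coefficients in the maximal ideal raise the order of every component by one, so `Θ` factors
  -- through the polynomial ring over the residue field.
  have hle : RingHom.ker (map (σ := ι) (residue R)) ≤ RingHom.ker Θ := by
    intro F hF
    rw [RingHom.mem_ker, map_residue_eq_zero_iff, mem_map_C_iff] at hF
    rw [RingHom.mem_ker, hΘ]
    intro r
    rw [mem_maximalIdeal_pow_iff_exists hπ]
    refine ⟨_, ?_, rfl⟩
    rw [← hx.span_eq]
    refine eval_mem_pow_succ_of_mem_map_C (homogeneousComponent_isHomogeneous r F) ?_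
    rw [hx.span_eq, mem_map_C_iff]
    intro d
    rw [coeff_homogeneousComponent]
    split_ifs
    exacts [hF d, Ideal.zero_mem _]
  refine ⟨RingHom.liftOfSurjective _ hres ⟨Θ, hle⟩, fun y ↦ ?_, fun G ↦ ?_⟩
  · obtain ⟨z, rfl⟩ := Ideal.Quotient.mk_surjective y
    obtain ⟨F, rfl⟩ := toRees_surjective x π hx hπ hπx z
    exact ⟨map (residue R) F, RingHom.liftOfSurjective_comp_apply _ hres _ F⟩
  · obtain ⟨F, rfl⟩ := hres G
    rw [RingHom.liftOfSurjective_comp_apply, hΘ]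
    refine forall_congr' fun r ↦ ?_
    have hmap : homogeneousComponent r (map (residue R) F) =
        map (residue R) (homogeneousComponent r F) := by
      ext d
      simp only [coeff_map, coeff_homogeneousComponent]
      split_ifs <;> simp
    have hF := homogeneousComponent_isHomogeneous r F
    have hFm := hx.eval_mem hF
    rw [hmap, ← ini_eval hx hF, mem_maximalIdeal_pow_iff_exists hπ]
    -- Vanishing in degree `r` means agreement modulo the kernel of `π` with an element of order
    -- above `r`; the difference is a kernel element with the same initial form.
    constructor
    · rintro ⟨f, hf, hfe⟩
      have hfr := Ideal.pow_le_pow_right r.le_succ hf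
      refine ⟨eval x (homogeneousComponent r F) - f, ?_, sub_mem hFm hfr, ?_⟩
      · rw [RingHom.mem_ker, map_sub, hfe, sub_self]
      · rw [ini_sub hx hFm hfr, (ini_eq_zero_iff hx hfr).mpr hf, sub_zero]
    · rintro ⟨f, hf, hfr, hfe⟩
      refine ⟨eval x (homogeneousComponent r F) - f, ?_, ?_⟩
      · rw [← ini_eq_zero_iff hx (sub_mem hFm hfr), ini_sub hx hFm hfr, hfe, sub_self]
      · rw [map_sub, RingHom.mem_ker.mp hf, sub_zero]

end AssociatedGraded
end MvPolynomial

namespace MvPolynomial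
open IsLocalRing CMGr

/-! ### Prime initial ideals and their determinantal structure. -/

section TangentCone

/-- A determinantal ideal given by a `3 × 2` matrix, two of whose maximal minors form a
complete intersection. -/
def IsLinkedDeterminantal {A : Type*} [CommRing A] (P : Ideal A) : Prop :=
  ∃ α β u v u' v' : A, KoszulExact (u * β - v * α) (u' * β - v' * α) ∧ (α ≠ 0 ∨ β ≠ 0) ∧
    u * β - v * α ≠ 0 ∧ u' * β - v' * α ≠ 0 ∧
    P = Ideal.span {u * β - v * α, u' * β - v' * α, u * v' - u' * v}

lemma isLinkedDeterminantal_span_pair {A : Type*} [CommRing A] [Nontrivial A] {F G : A}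
    (h : KoszulExact F G) (hF : F ≠ 0) (hG : G ≠ 0) :
    IsLinkedDeterminantal (Ideal.span {F, G}) := by
  -- With `α = 1` and `β = u = u' = 0` the three minors are `F`, `G` and `0`.
  refine ⟨1, 0, 0, -F, 0, -G, by simpa using h, by simp, by simpa using hF, by simpa using hG, ?_⟩
  have : ({F, G, 0} : Set A) = insert 0 {F, G} := by ext; simp; tauto
  simp [this, Ideal.span_insert]

variable {R : Type u} [CommRing R] [IsLocalRing R] {ι : Type*} {x : ι → R}
  (hx : IsRegularParameters x) {I : Ideal R} {P : Ideal (MvPolynomial ι (ResidueField R))}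

section Degree

variable {k : Type*} [Field k]

lemma isUnit_of_totalDegree_eq_zero {G : MvPolynomial ι k} (hG : G ≠ 0) (h : G.totalDegree = 0) :
    IsUnit G := by
  rw [totalDegree_eq_zero_iff_eq_C] at h
  rw [h] at hG ⊢
  exact (isUnit_iff_ne_zero.mpr fun h0 ↦ hG (by rw [h0, map_zero])).map C

lemma eq_zero_of_dvd_of_isHomogeneous {F G : MvPolynomial ι k} {q r : ℕ} (hF : F.IsHomogeneous r)
    (hG : G.IsHomogeneous q) (hqr : q < r) (h : F ∣ G) : G = 0 := by
  by_contra hG0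
  obtain ⟨c, rfl⟩ := h
  have h1 := left_ne_zero_of_mul hG0
  have h2 := totalDegree_mul_of_isDomain h1 (right_ne_zero_of_mul hG0)
  rw [hG.totalDegree hG0, hF.totalDegree h1] at h2
  omega

lemma prime_of_isHomogeneous_one {F : MvPolynomial ι k} (hF : F.IsHomogeneous 1) (hF0 : F ≠ 0) :
    Prime F := by
  refine Irreducible.prime ⟨fun hu ↦ ?_, fun u v huv ↦ ?_⟩
  · exact one_ne_zero (eq_zero_of_dvd_of_isHomogeneous hF (isHomogeneous_one ι k) (by omega)
      hu.dvd)
  · rw [huv] at hF hF0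
    have h1 := left_ne_zero_of_mul hF0
    have h2 := right_ne_zero_of_mul hF0
    have h3 := totalDegree_mul_of_isDomain h1 h2
    rw [hF.totalDegree hF0] at h3
    obtain h | h : u.totalDegree = 0 ∨ v.totalDegree = 0 := by omega
    · exact Or.inl (isUnit_of_totalDegree_eq_zero h1 h)
    · exact Or.inr (isUnit_of_totalDegree_eq_zero h2 h)

end Degree

/-- `P` is the ideal generated by the initial forms of the elements of `I`. -/
def IsInitialIdeal (x : ι → R) (I : Ideal R) (P : Ideal (MvPolynomial ι (ResidueField R))) : Prop :=
  ∀ G, G ∈ P ↔ ∀ r, ∃ f ∈ I, f ∈ maximalIdeal R ^ r ∧ ini x r f = homogeneousComponent r G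

variable (hP : IsInitialIdeal x I P)

include hx

lemma ini_zero (r : ℕ) : ini x r 0 = 0 :=
  (ini_eq_zero_iff hx (Ideal.zero_mem _)).mpr (Ideal.zero_mem _)

/-- Orders add because a polynomial ring over a field is a domain. -/
lemma mem_pow_sub_of_mul_mem_pow {p r : ℕ} {a b : R} (hb : b ∈ maximalIdeal R ^ p)
    (hb' : b ∉ maximalIdeal R ^ (p + 1)) (hab : a * b ∈ maximalIdeal R ^ r) :
    a ∈ maximalIdeal R ^ (r - p) := by
  suffices ∀ j ≤ r - p, a ∈ maximalIdeal R ^ j from this _ le_rfl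
  intro j
  induction j with
  | zero => simp
  | succ j ih =>
    intro hj
    have ha := ih (by omega)
    have h1 := ini_mul hx ha hb
    have hne : ini x p b ≠ 0 := by rwa [Ne, ini_eq_zero_iff hx hb]
    rw [(ini_eq_zero_iff hx (Ideal.pow_le_pow_right (by omega) hab)).mpr
      (Ideal.pow_le_pow_right (by omega) hab)] at h1
    rw [← ini_eq_zero_iff hx ha]
    exact (mul_eq_zero.mp h1.symm).resolve_right hne

include hP

lemma IsInitialIdeal.ini_mem {f : R} (hf : f ∈ I) {r : ℕ} (hfr : f ∈ maximalIdeal R ^ r) :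
    ini x r f ∈ P := by
  rw [hP]
  intro t
  rw [homogeneousComponent_of_mem (ini_isHomogeneous r f)]
  split_ifs with h
  · subst h; exact ⟨f, hf, hfr, rfl⟩
  · exact ⟨0, I.zero_mem, Ideal.zero_mem _, ini_zero hx t⟩

lemma IsInitialIdeal.homogeneousComponent_eq_zero {r : ℕ} (hI : I ≤ maximalIdeal R ^ r)
    {G : MvPolynomial ι (ResidueField R)} (hG : G ∈ P) {q : ℕ} (hq : q < r) :
    homogeneousComponent q G = 0 := by
  obtain ⟨f, hf, hfq, hfe⟩ := (hP G).mp hG q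
  rw [← hfe, ini_eq_zero_iff hx hfq]
  exact Ideal.pow_le_pow_right hq (hI hf)

lemma IsInitialIdeal.notMem_of_isHomogeneous {r : ℕ} (hI : I ≤ maximalIdeal R ^ r)
    {G : MvPolynomial ι (ResidueField R)} {q : ℕ} (hG : G.IsHomogeneous q) (hG0 : G ≠ 0)
    (hq : q < r) : G ∉ P := fun h ↦ hG0 <| by
  rw [← homogeneousComponent_eq_self hG]
  exact hP.homogeneousComponent_eq_zero hx hI h hq

lemma IsInitialIdeal.le_totalDegree {r : ℕ} (hI : I ≤ maximalIdeal R ^ r)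
    {G : MvPolynomial ι (ResidueField R)} (hG : G ∈ P) (hG0 : G ≠ 0) : r ≤ G.totalDegree := by
  by_contra! hlt
  apply hG0
  rw [← sum_homogeneousComponent G]
  refine Finset.sum_eq_zero fun i hi ↦ hP.homogeneousComponent_eq_zero hx hI hG ?_
  rw [Finset.mem_range] at hi; omega

/-- An initial form of least degree in a prime initial ideal is a prime element. -/
lemma IsInitialIdeal.prime_ini (hPp : P.IsPrime) {r : ℕ} (hI : I ≤ maximalIdeal R ^ r) {f : R}
    (hf : f ∈ I) (hf' : f ∉ maximalIdeal R ^ (r + 1)) : Prime (ini x r f) := by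
  have hmem := hP.ini_mem hx hf (hI hf)
  have hne : ini x r f ≠ 0 := by rwa [Ne, ini_eq_zero_iff hx (hI hf)]
  refine Irreducible.prime ⟨fun hu ↦ hPp.ne_top (Ideal.eq_top_of_isUnit_mem _ hmem hu), ?_⟩
  intro u v huv
  have h1 : u ≠ 0 := left_ne_zero_of_mul (huv ▸ hne)
  have h2 : v ≠ 0 := right_ne_zero_of_mul (huv ▸ hne)
  have h3 := totalDegree_mul_of_isDomain h1 h2
  rw [← huv, (ini_isHomogeneous r f).totalDegree hne] at h3
  obtain h | h := hPp.mem_or_mem (huv ▸ hmem)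
  · have := hP.le_totalDegree hx hI h h1
    exact Or.inr (isUnit_of_totalDegree_eq_zero h2 (by omega))
  · have := hP.le_totalDegree hx hI h h2
    exact Or.inl (isUnit_of_totalDegree_eq_zero h1 (by omega))

omit hx in
lemma IsInitialIdeal.le_of_forall_ini_mem {J : Ideal (MvPolynomial ι (ResidueField R))}
    (h : ∀ f ∈ I, ∀ r, f ∈ maximalIdeal R ^ r → ini x r f ∈ J) : P ≤ J := by
  intro G hG
  rw [← sum_homogeneousComponent G]
  refine Ideal.sum_mem _ fun t _ ↦ ?_
  obtain ⟨f, hf, hft, hfe⟩ := (hP G).mp hG t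
  rw [← hfe]
  exact h f hf t hft

lemma IsInitialIdeal.mul_mem_span_pair {f₁ f₂ c : R} {r s p : ℕ} (hf₁ : f₁ ∈ maximalIdeal R ^ r)
    (hf₂ : f₂ ∈ maximalIdeal R ^ s) (hK : KoszulExact (ini x r f₁) (ini x s f₂))
    (hc : c ∈ maximalIdeal R ^ p) (hle : ∀ f ∈ I, f * c ∈ Ideal.span {f₁, f₂})
    {G : MvPolynomial ι (ResidueField R)} (hG : G ∈ P) :
    G * ini x p c ∈ Ideal.span {ini x r f₁, ini x s f₂} := by
  rw [← sum_homogeneousComponent G, Finset.sum_mul]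
  refine Ideal.sum_mem _ fun t _ ↦ ?_
  obtain ⟨f, hf, hft, hfe⟩ := (hP G).mp hG t
  rw [← hfe, ← ini_mul hx hft hc]
  exact ini_mem_span_pair hx hf₁ hf₂ hK
    (by rw [pow_add]; exact Ideal.mul_mem_mul hft hc) (hle f hf)

/-- If the initial forms of a row of the Hilbert–Burch matrix form a complete intersection, then
linkage is compatible with taking initial ideals. -/
theorem IsInitialIdeal.isLinkedDeterminantal_of_koszulExact (hPp : P.IsPrime)
    {f₁ f₂ f₃ a₁ a₂ a₃ b₁ b₂ b₃ : R} {p q r s : ℕ} (h₁ : f₁ = a₂ * b₃ - a₃ * b₂)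
    (h₂ : f₂ = a₃ * b₁ - a₁ * b₃) (h₃ : f₃ = a₁ * b₂ - a₂ * b₁)
    (hI : I = Ideal.span {f₁, f₂, f₃}) (hf₁ : f₁ ∈ maximalIdeal R ^ r)
    (hf₂ : f₂ ∈ maximalIdeal R ^ s) (hF₁ : Prime (ini x r f₁))
    (hF₂ : ini x s f₂ ∉ Ideal.span {ini x r f₁}) (ha₃ : a₃ ∈ maximalIdeal R ^ q)
    (hb₃ : b₃ ∈ maximalIdeal R ^ p) (hαβ : KoszulExact (ini x q a₃) (ini x p b₃))
    (hnot : ini x q a₃ ∉ P ∨ ini x p b₃ ∉ P) : IsLinkedDeterminantal P := by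
  have hK : KoszulExact (ini x r f₁) (ini x s f₂) := .of_isRelPrime <|
    hF₁.irreducible.isRelPrime_iff_not_dvd.mpr (by rwa [← Ideal.mem_span_singleton])
  have hF₂0 : ini x s f₂ ≠ 0 := fun h ↦ hF₂ (by rw [h]; exact Ideal.zero_mem _)
  have hF₁0 := hF₁.ne_zero
  -- Both `f₁` and `f₂` lie in `(a₃, b₃)`, whose initial ideal is generated by the two coprime
  -- initial forms.
  obtain ⟨v, u, huv⟩ := Ideal.mem_span_pair.mp <| ini_mem_span_pair hx ha₃ hb₃ hαβ hf₁
    (Ideal.mem_span_pair.mpr ⟨-b₂, a₂, by rw [h₁]; ring⟩)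
  obtain ⟨v', u', huv'⟩ := Ideal.mem_span_pair.mp <| ini_mem_span_pair hx ha₃ hb₃ hαβ hf₂
    (Ideal.mem_span_pair.mpr ⟨b₁, -a₁, by rw [h₂]; ring⟩)
  have e₁ : ini x r f₁ = u * ini x p b₃ - (-v) * ini x q a₃ := by rw [← huv]; ring
  have e₂ : ini x s f₂ = u' * ini x p b₃ - (-v') * ini x q a₃ := by rw [← huv']; ring
  -- The relation `a₁ f₁ + a₂ f₂ + a₃ f₃ = 0` gives `a₃ I ⊆ (f₁, f₂)`; the inclusion passes to
  -- initial forms.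
  have hmulα : ∀ G ∈ P, G * ini x q a₃ ∈ Ideal.span {ini x r f₁, ini x s f₂} := fun G hG ↦ by
    refine hP.mul_mem_span_pair hx hf₁ hf₂ hK ha₃ (fun f hf ↦ ?_) hG
    rw [hI, Ideal.mem_span_insert] at hf
    obtain ⟨c₁, z, hz, rfl⟩ := hf
    obtain ⟨c₂, c₃, rfl⟩ := Ideal.mem_span_pair.mp hz
    exact Ideal.mem_span_pair.mpr ⟨c₁ * a₃ - c₃ * a₁, c₂ * a₃ - c₃ * a₂, by
      rw [h₁, h₂, h₃]; ring⟩
  have hmulβ : ∀ G ∈ P, G * ini x p b₃ ∈ Ideal.span {ini x r f₁, ini x s f₂} := fun G hG ↦ by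
    refine hP.mul_mem_span_pair hx hf₁ hf₂ hK hb₃ (fun f hf ↦ ?_) hG
    rw [hI, Ideal.mem_span_insert] at hf
    obtain ⟨c₁, z, hz, rfl⟩ := hf
    obtain ⟨c₂, c₃, rfl⟩ := Ideal.mem_span_pair.mp hz
    exact Ideal.mem_span_pair.mpr ⟨c₁ * b₃ - c₃ * b₁, c₂ * b₃ - c₃ * b₂, by
      rw [h₁, h₂, h₃]; ring⟩
  have hne : ini x q a₃ ≠ 0 ∨ ini x p b₃ ≠ 0 :=
    hnot.imp (fun h h0 ↦ h (h0 ▸ P.zero_mem)) fun h h0 ↦ h (h0 ▸ P.zero_mem)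
  have m₁ : ini x r f₁ ∈ P := hP.ini_mem hx (by rw [hI]; exact Ideal.subset_span (by simp)) hf₁
  have m₂ : ini x s f₂ ∈ P := hP.ini_mem hx (by rw [hI]; exact Ideal.subset_span (by simp)) hf₂
  have hle : Ideal.span {ini x r f₁, ini x s f₂} ≤ P := by
    rw [Ideal.span_le]; rintro _ (rfl | rfl); exacts [m₁, m₂]
  refine ⟨ini x q a₃, ini x p b₃, u, -v, u', -v', by rwa [← e₁, ← e₂], hne, by rwa [← e₁],
    by rwa [← e₂], le_antisymm (fun G hG ↦ ?_) ?_⟩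
  · refine mem_span_of_mul_mem_span_pair hαβ (by rwa [← e₁, ← e₂]) hne ?_ ?_
    · rw [← e₁, ← e₂]; exact hmulα G hG
    · rw [← e₁, ← e₂]; exact hmulβ G hG
  · rw [← e₁, ← e₂, Ideal.span_le]
    rintro _ (rfl | rfl | rfl)
    · exact m₁
    · exact m₂
    -- Either initial form multiplies the determinant into `P`, and one of them is not in the prime
    -- `P`.
    · obtain h | h := hnot
      · refine (hPp.mem_or_mem (hle ?_)).resolve_right h
        exact Ideal.mem_span_pair.mpr ⟨u', -u, by rw [e₁, e₂]; ring⟩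
      · refine (hPp.mem_or_mem (hle ?_)).resolve_right h
        exact Ideal.mem_span_pair.mpr ⟨-v', v, by rw [e₁, e₂]; ring⟩

/-- The case where the initial form of the first minor is the corresponding minor of the
initial forms. -/
theorem IsInitialIdeal.isLinkedDeterminantal_of_orders (hPp : P.IsPrime)
    {f₁ f₂ f₃ a₁ a₂ a₃ b₁ b₂ b₃ : R} {p q r s : ℕ} (h₁ : f₁ = a₂ * b₃ - a₃ * b₂)
    (h₂ : f₂ = a₃ * b₁ - a₁ * b₃) (h₃ : f₃ = a₁ * b₂ - a₂ * b₁)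
    (hI : I = Ideal.span {f₁, f₂, f₃}) (hIr : I ≤ maximalIdeal R ^ r)
    (hf₂ : f₂ ∈ maximalIdeal R ^ s) (hF₁ : Prime (ini x r f₁))
    (hF₂ : ini x s f₂ ∉ Ideal.span {ini x r f₁}) (hpr : p < r) (hqr : q < r)
    (ha₂ : a₂ ∈ maximalIdeal R ^ (r - p)) (ha₃ : a₃ ∈ maximalIdeal R ^ q)
    (hb₂ : b₂ ∈ maximalIdeal R ^ (r - q)) (hb₃ : b₃ ∈ maximalIdeal R ^ p) :
    IsLinkedDeterminantal P := by
  have hf₁ : f₁ ∈ maximalIdeal R ^ r := hIr (by rw [hI]; exact Ideal.subset_span (by simp))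
  have e : ini x r f₁ = ini x (r - p) a₂ * ini x p b₃ - ini x q a₃ * ini x (r - q) b₂ := by
    have e1 : r - p + p = r := by omega
    have e2 : q + (r - q) = r := by omega
    have k1 := ini_mul hx ha₂ hb₃
    have k2 := ini_mul hx ha₃ hb₂
    have l1 := Ideal.mul_mem_mul ha₂ hb₃
    have l2 := Ideal.mul_mem_mul ha₃ hb₂
    rw [← pow_add, e1] at l1
    rw [← pow_add, e2] at l2
    rw [e1] at k1
    rw [e2] at k2
    rw [h₁, ini_sub hx l1 l2, k1, k2]
  have hαβ : ini x q a₃ ≠ 0 ∨ ini x p b₃ ≠ 0 := by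
    by_contra! h
    exact hF₁.ne_zero (by rw [e, h.1, h.2]; ring)
  refine hP.isLinkedDeterminantal_of_koszulExact hx hPp h₁ h₂ h₃ hI hf₁ hf₂ hF₁ hF₂ ha₃ hb₃
    (.of_isRelPrime fun d hdα hdβ ↦ ?_) ?_
  -- A common factor divides the irreducible initial form of `f₁`. It is a unit, or an associate of
  -- it and then of too large a degree to divide a nonzero initial form of `a₃` or `b₃`.
  · have hd : d ∣ ini x r f₁ := by
      rw [e]; exact dvd_sub (hdβ.mul_left _) (hdα.mul_right _)
    obtain ⟨c, hc⟩ := hd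
    refine (hF₁.irreducible.isUnit_or_isUnit hc).resolve_right fun hcu ↦ ?_
    have hdvd : ini x r f₁ ∣ d := by rw [hc]; exact hcu.mul_right_dvd.mpr dvd_rfl
    have z1 := eq_zero_of_dvd_of_isHomogeneous (ini_isHomogeneous r f₁) (ini_isHomogeneous q a₃)
      hqr (hdvd.trans hdα)
    have z2 := eq_zero_of_dvd_of_isHomogeneous (ini_isHomogeneous r f₁) (ini_isHomogeneous p b₃)
      hpr (hdvd.trans hdβ)
    exact hαβ.elim (· z1) (· z2)
  · exact hαβ.imp (fun h ↦ hP.notMem_of_isHomogeneous hx hIr (ini_isHomogeneous _ _) h hqr)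
      fun h ↦ hP.notMem_of_isHomogeneous hx hIr (ini_isHomogeneous _ _) h hpr

/-- The case where an entry of the Hilbert–Burch matrix has order one. -/
theorem IsInitialIdeal.isLinkedDeterminantal_of_notMem_sq [IsNoetherianRing R] (hPp : P.IsPrime)
    {f₁ f₂ f₃ a₁ a₂ a₃ b₁ b₂ b₃ : R} {r s : ℕ} (h₁ : f₁ = a₂ * b₃ - a₃ * b₂)
    (h₂ : f₂ = a₃ * b₁ - a₁ * b₃) (h₃ : f₃ = a₁ * b₂ - a₂ * b₁)
    (hI : I = Ideal.span {f₁, f₂, f₃}) (hIr : I ≤ maximalIdeal R ^ r)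
    (hf₂ : f₂ ∈ maximalIdeal R ^ s) (hF₁ : Prime (ini x r f₁))
    (hF₂ : ini x s f₂ ∉ Ideal.span {ini x r f₁}) (hr : 2 ≤ r) (hb₂ : b₂ ∈ maximalIdeal R)
    (hb₃ : b₃ ∈ maximalIdeal R) (hb₃' : b₃ ∉ maximalIdeal R ^ 2) :
    IsLinkedDeterminantal P := by
  have hf₁ : f₁ ∈ maximalIdeal R ^ r := hIr (by rw [hI]; exact Ideal.subset_span (by simp))
  rw [← pow_one (maximalIdeal R)] at hb₂ hb₃
  by_cases ha₃ : a₃ ∈ Ideal.span {b₃}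
  -- A column operation makes `a₃` zero, and `r - 1` is a formal order for it. The case is in fact
  -- contradictory, the linear form of `b₃` dividing the prime form of degree `r ≥ 2`, but the order
  -- criterion covers it.
  · obtain ⟨c, hc⟩ := Ideal.mem_span_singleton'.mp ha₃
    refine hP.isLinkedDeterminantal_of_orders hx hPp (a₁ := a₁ - c * b₁) (a₂ := a₂ - c * b₂)
      (a₃ := a₃ - c * b₃) (b₁ := b₁) (b₂ := b₂) (b₃ := b₃) (p := 1) (q := r - 1)
      (by rw [h₁]; ring) (by rw [h₂]; ring) (by rw [h₃]; ring) hI hIr hf₂ hF₁ hF₂ (by omega)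
      (by omega) ?_ ?_ ?_ hb₃
    · refine mem_pow_sub_of_mul_mem_pow hx hb₃ hb₃' ?_
      rw [show (a₂ - c * b₂) * b₃ = f₁ by rw [h₁, ← hc]; ring]
      exact hf₁
    · rw [hc, sub_self]; exact Ideal.zero_mem _
    · rwa [show r - (r - 1) = 1 by omega]
  -- Subtracting `c` times column `b` from column `a` makes the initial form of `a₃` indivisible by
  -- the linear prime of `b₃`.
  · obtain ⟨c, q, hq, hnot⟩ := exists_ini_sub_mul_notMem_span hx hb₃ ha₃
    have hβ : ini x 1 b₃ ≠ 0 := by rwa [Ne, ini_eq_zero_iff hx hb₃]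
    have hβp := prime_of_isHomogeneous_one (ini_isHomogeneous 1 b₃) hβ
    refine hP.isLinkedDeterminantal_of_koszulExact hx hPp (a₁ := a₁ - c * b₁) (a₂ := a₂ - c * b₂)
      (a₃ := a₃ - c * b₃) (b₁ := b₁) (b₂ := b₂) (b₃ := b₃)
      (by rw [h₁]; ring) (by rw [h₂]; ring) (by rw [h₃]; ring) hI hf₁ hf₂ hF₁ hF₂ hq hb₃
      (.of_isRelPrime (hβp.irreducible.isRelPrime_iff_not_dvd.mpr
        (by rwa [← Ideal.mem_span_singleton])).symm)
      (Or.inr (hP.notMem_of_isHomogeneous hx hIr (ini_isHomogeneous _ _) hβ (by omega)))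

theorem IsInitialIdeal.isLinkedDeterminantal_of_normalized [IsNoetherianRing R] (hPp : P.IsPrime)
    {f₁ f₂ f₃ a₁ a₂ a₃ b₁ b₂ b₃ : R} {r s t : ℕ} (h₁ : f₁ = a₂ * b₃ - a₃ * b₂)
    (h₂ : f₂ = a₃ * b₁ - a₁ * b₃) (h₃ : f₃ = a₁ * b₂ - a₂ * b₁)
    (hI : I = Ideal.span {f₁, f₂, f₃}) (hIr : I ≤ maximalIdeal R ^ r)
    (hf₂ : f₂ ∈ maximalIdeal R ^ s) (hf₃ : f₃ ∈ maximalIdeal R ^ t) (hF₁ : Prime (ini x r f₁))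
    (hF₂ : ini x s f₂ ∉ Ideal.span {ini x r f₁}) (hF₃ : ini x t f₃ ∉ Ideal.span {ini x r f₁})
    (hr4 : r ≤ 4) (ha₂ : a₂ ∈ maximalIdeal R) (ha₃ : a₃ ∈ maximalIdeal R)
    (hb₂ : b₂ ∈ maximalIdeal R) (hb₃ : b₃ ∈ maximalIdeal R) :
    IsLinkedDeterminantal P := by
  have hf₁ : f₁ ∈ maximalIdeal R ^ r := hIr (by rw [hI]; exact Ideal.subset_span (by simp))
  have hr2 : 2 ≤ r := by
    by_contra! hlt
    apply hF₁.ne_zero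
    rw [ini_eq_zero_iff hx hf₁]
    refine Ideal.pow_le_pow_right (show r + 1 ≤ 2 by omega) ?_
    rw [h₁, pow_two]
    exact sub_mem (Ideal.mul_mem_mul ha₂ hb₃) (Ideal.mul_mem_mul ha₃ hb₂)
  have hI' : I = Ideal.span {f₁, f₃, -f₂} := by
    rw [hI, Ideal.span_insert, Ideal.span_insert f₁, Ideal.span_insert, Ideal.span_insert f₃,
      Ideal.span_singleton_neg, sup_comm (Ideal.span {f₂})]
  -- An entry of order one is moved to the place of `b₃` by exchanging columns or rows 2 and 3, with
  -- signs chosen to keep `f₁`; exchanging rows trades `f₂` for `f₃`.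
  by_cases k1 : b₃ ∈ maximalIdeal R ^ 2
  swap
  · exact hP.isLinkedDeterminantal_of_notMem_sq hx hPp h₁ h₂ h₃ hI hIr hf₂ hF₁ hF₂ hr2 hb₂ hb₃ k1
  by_cases k2 : a₃ ∈ maximalIdeal R ^ 2
  swap
  · exact hP.isLinkedDeterminantal_of_notMem_sq hx hPp (a₁ := b₁) (a₂ := b₂) (a₃ := b₃)
      (b₁ := -a₁) (b₂ := -a₂) (b₃ := -a₃) (by rw [h₁]; ring) (by rw [h₂]; ring) (by rw [h₃]; ring)
      hI hIr hf₂ hF₁ hF₂ hr2 (neg_mem ha₂) (neg_mem ha₃) (by rwa [neg_mem_iff])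
  by_cases k3 : b₂ ∈ maximalIdeal R ^ 2
  swap
  · exact hP.isLinkedDeterminantal_of_notMem_sq hx hPp (a₁ := a₁) (a₂ := a₃) (a₃ := -a₂)
      (b₁ := b₁) (b₂ := b₃) (b₃ := -b₂) (by rw [h₁]; ring) (by rw [h₃]; ring) (by rw [h₂]; ring)
      hI' hIr hf₃ hF₁ hF₃ hr2 hb₃ (neg_mem hb₂) (by rwa [neg_mem_iff])
  by_cases k4 : a₂ ∈ maximalIdeal R ^ 2
  swap
  · exact hP.isLinkedDeterminantal_of_notMem_sq hx hPp (a₁ := b₁) (a₂ := b₃) (a₃ := -b₂)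
      (b₁ := -a₁) (b₂ := -a₃) (b₃ := a₂) (by rw [h₁]; ring) (by rw [h₃]; ring) (by rw [h₂]; ring)
      hI' hIr hf₃ hF₁ hF₃ hr2 (neg_mem ha₃) ha₂ k4
  -- All four entries lie in `m²`, so `f₁ ∈ m⁴`, forcing `r = 4` and orders 2 throughout; the
  -- minimum spares deriving this. Only here is `r ≤ 4` needed.
  exact hP.isLinkedDeterminantal_of_orders hx hPp (p := min 2 (r - 1)) (q := min 2 (r - 1))
    h₁ h₂ h₃ hI hIr hf₂ hF₁ hF₂ (by omega) (by omega)
    (Ideal.pow_le_pow_right (by omega) k4) (Ideal.pow_le_pow_right (by omega) k2)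
    (Ideal.pow_le_pow_right (by omega) k3) (Ideal.pow_le_pow_right (by omega) k1)

end TangentCone
end MvPolynomial

namespace MvPolynomial
open IsLocalRing CMGr

lemma spanFinrank_span_pair_le {R : Type*} [CommRing R] (f g : R) :
    (Ideal.span {f, g}).spanFinrank ≤ 2 :=
  (Submodule.spanFinrank_span_le_ncard_of_finite (Set.toFinite _)).trans
    ((Set.ncard_insert_le f {g}).trans (by rw [Set.ncard_singleton]))

/-! ### Choice of generators and normalization. -/

section Generators

variable {R : Type u} [CommRing R] [IsLocalRing R]

/-- The coefficients of a relation between three minimal generators are not units. -/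
lemma mem_maximalIdeal_of_relation {f g h a b c : R}
    (hI : (Ideal.span {f, g, h}).spanFinrank = 3) (hrel : a * f + b * g + c * h = 0) :
    a ∈ maximalIdeal R := by
  by_contra ha
  obtain ⟨d, hd⟩ := (of_not_not ha : IsUnit a).exists_left_inv
  have hf : f ∈ Ideal.span {g, h} :=
    Ideal.mem_span_pair.mpr ⟨-(d * b), -(d * c), by linear_combination f * hd - d * hrel⟩
  have e : Ideal.span {f, g, h} = Ideal.span {g, h} := by
    rw [Ideal.span_insert, sup_eq_right, Ideal.span_singleton_le_iff_mem]
    exact hf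
  have := spanFinrank_span_pair_le g h
  rw [← e, hI] at this
  omega

/-- The order of a nonzero proper ideal. -/
lemma exists_le_pow_not_le_pow_succ [IsNoetherianRing R] {I : Ideal R} (hI : I ≠ ⊥) :
    ∃ r, I ≤ maximalIdeal R ^ r ∧ ¬ I ≤ maximalIdeal R ^ (r + 1) := by
  classical
  obtain ⟨f, hf, hf0⟩ := Submodule.exists_mem_ne_zero_of_ne_bot hI
  obtain ⟨t, -, ht⟩ := exists_mem_pow_notMem_pow_succ hf0
  have hex : ∃ n, ¬ I ≤ maximalIdeal R ^ n := ⟨t + 1, fun h ↦ ht (h hf)⟩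
  have hpos : Nat.find hex ≠ 0 := fun h0 ↦ Nat.find_spec hex (by rw [h0]; simp)
  obtain ⟨r, hr⟩ := Nat.exists_eq_succ_of_ne_zero hpos
  exact ⟨r, not_not.mp (Nat.find_min hex (by omega)), by
    have := Nat.find_spec hex
    rwa [hr] at this⟩

variable [IsNoetherianRing R] {ι : Type*} {x : ι → R} (hx : IsRegularParameters x) {I : Ideal R}
  {P : Ideal (MvPolynomial ι (ResidueField R))} (hP : IsInitialIdeal x I P)

include hx hP

/-- The initial ideal of a complete intersection. -/
lemma IsInitialIdeal.isLinkedDeterminantal_of_eq_span_pair (hPp : P.IsPrime) {f g : R} {r : ℕ}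
    (hI : I = Ideal.span {f, g}) (hIr : I ≤ maximalIdeal R ^ r)
    (hf : f ∉ maximalIdeal R ^ (r + 1)) (hg : g ∉ Ideal.span {f}) :
    IsLinkedDeterminantal P := by
  have hfI : f ∈ I := by rw [hI]; exact Ideal.subset_span (by simp)
  have hgI : g ∈ I := by rw [hI]; exact Ideal.subset_span (by simp)
  obtain ⟨c, s, hs, hnot⟩ := exists_ini_sub_mul_notMem_span hx (hIr hfI) hg
  have hF := hP.prime_ini hx hPp hIr hfI hf
  have hK : KoszulExact (ini x r f) (ini x s (g - c * f)) := .of_isRelPrime <|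
    hF.irreducible.isRelPrime_iff_not_dvd.mpr (by rwa [← Ideal.mem_span_singleton])
  have hPe : P = Ideal.span {ini x r f, ini x s (g - c * f)} := by
    refine le_antisymm (hP.le_of_forall_ini_mem fun h hh t ht ↦ ?_) ?_
    · refine ini_mem_span_pair hx (hIr hfI) hs hK ht ?_
      rw [hI] at hh
      obtain ⟨a, b, rfl⟩ := Ideal.mem_span_pair.mp hh
      exact Ideal.mem_span_pair.mpr ⟨a + b * c, b, by ring⟩
    · rw [Ideal.span_le]
      rintro _ (rfl | rfl)
      · exact hP.ini_mem hx hfI (hIr hfI)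
      · exact hP.ini_mem hx (sub_mem hgI (I.mul_mem_left _ hfI)) hs
  rw [hPe]
  exact isLinkedDeterminantal_span_pair hK hF.ne_zero
    fun h0 ↦ hnot (by rw [h0]; exact Ideal.zero_mem _)

lemma IsInitialIdeal.isLinkedDeterminantal_of_spanFinrank_le_two (hPp : P.IsPrime)
    (hheight : I.height = 2) (htop : I ≠ ⊤) (hbot : I ≠ ⊥) (hgen : I.spanFinrank ≤ 2) :
    IsLinkedDeterminantal P := by
  classical
  have hrank : I.spanFinrank = 2 := by
    refine le_antisymm hgen ?_
    have := Ideal.height_le_spanFinrank I htop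
    rw [hheight] at this
    exact_mod_cast this
  obtain ⟨s, hs, hspan⟩ := Submodule.FG.exists_span_finset_card_eq_spanFinrank
    (IsNoetherian.noetherian I)
  rw [hrank, Finset.card_eq_two] at hs
  obtain ⟨f, g, -, rfl⟩ := hs
  have hI : I = Ideal.span {f, g} := by rw [← hspan]; simp [Ideal.span]
  obtain ⟨r, hIr, hr⟩ := exists_le_pow_not_le_pow_succ hbot
  -- Otherwise `I` would be principal, of height at most one.
  have key : ∀ f g, I = Ideal.span {f, g} → g ∉ Ideal.span {f} := by
    intro f g hI hg
    have e : I = Ideal.span {f} := by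
      rw [hI, Set.pair_comm, Ideal.span_insert, sup_eq_right, Ideal.span_singleton_le_iff_mem]
      exact hg
    have hu : ¬ IsUnit f := fun hu ↦ htop (by rw [e, Ideal.span_singleton_eq_top.mpr hu])
    have := height_span_singleton_le_one hu
    rw [← e, hheight] at this
    exact absurd this (by decide)
  by_cases hf : f ∈ maximalIdeal R ^ (r + 1)
  · have hg : g ∉ maximalIdeal R ^ (r + 1) := fun hg ↦ hr <| by
      rw [hI, Ideal.span_le]
      rintro _ (rfl | rfl)
      exacts [hf, hg]
    have hI' := hI.trans (by rw [Set.pair_comm])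
    exact hP.isLinkedDeterminantal_of_eq_span_pair hx hPp hI' hIr hg (key _ _ hI')
  · exact hP.isLinkedDeterminantal_of_eq_span_pair hx hPp hI hIr hf (key _ _ hI)

lemma IsInitialIdeal.isLinkedDeterminantal_of_minors (hPp : P.IsPrime)
    {f₁ f₂ f₃ a₁ a₂ a₃ b₁ b₂ b₃ : R} {r : ℕ} (h₁ : f₁ = a₂ * b₃ - a₃ * b₂)
    (h₂ : f₂ = a₃ * b₁ - a₁ * b₃) (h₃ : f₃ = a₁ * b₂ - a₂ * b₁)
    (hI : I = Ideal.span {f₁, f₂, f₃}) (hIr : I ≤ maximalIdeal R ^ r)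
    (hf₁ : f₁ ∉ maximalIdeal R ^ (r + 1)) (hgen : I.spanFinrank = 3) (hr : r ≤ 4) :
    IsLinkedDeterminantal P := by
  have hf₁I : f₁ ∈ I := by rw [hI]; exact Ideal.subset_span (by simp)
  have hI₂ : I = Ideal.span {f₂, f₁, f₃} := by rw [hI, Set.insert_comm]
  have hI₃ : I = Ideal.span {f₃, f₁, f₂} := by
    rw [hI, Set.pair_comm f₂, Set.insert_comm]
  have r₂ : (Ideal.span {f₂, f₁, f₃}).spanFinrank = 3 := by rw [← hI₂]; exact hgen
  have r₃ : (Ideal.span {f₃, f₁, f₂}).spanFinrank = 3 := by rw [← hI₃]; exact hgen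
  have n₂ : f₂ ∉ Ideal.span {f₁} := fun h ↦ by
    obtain ⟨c, hc⟩ := Ideal.mem_span_singleton'.mp h
    have : (1 : R) ∈ maximalIdeal R := mem_maximalIdeal_of_relation (a := 1) (b := -c) (c := 0) r₂
      (by rw [← hc]; ring)
    exact this isUnit_one
  have n₃ : f₃ ∉ Ideal.span {f₁} := fun h ↦ by
    obtain ⟨c, hc⟩ := Ideal.mem_span_singleton'.mp h
    have : (1 : R) ∈ maximalIdeal R := mem_maximalIdeal_of_relation (a := 1) (b := -c) (c := 0) r₃
      (by rw [← hc]; ring)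
    exact this isUnit_one
  -- The columns of the matrix are syzygies of the minors, which are minimal generators.
  have ha₂ : a₂ ∈ maximalIdeal R := mem_maximalIdeal_of_relation (b := a₁) (c := a₃) r₂
    (by rw [h₁, h₂, h₃]; ring)
  have ha₃ : a₃ ∈ maximalIdeal R := mem_maximalIdeal_of_relation (b := a₁) (c := a₂) r₃
    (by rw [h₁, h₂, h₃]; ring)
  have hb₂ : b₂ ∈ maximalIdeal R := mem_maximalIdeal_of_relation (b := b₁) (c := b₃) r₂
    (by rw [h₁, h₂, h₃]; ring)
  have hb₃ : b₃ ∈ maximalIdeal R := mem_maximalIdeal_of_relation (b := b₁) (c := b₂) r₃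
    (by rw [h₁, h₂, h₃]; ring)
  obtain ⟨c, s, hs, hF₂⟩ := exists_ini_sub_mul_notMem_span hx (hIr hf₁I) n₂
  obtain ⟨d, t, ht, hF₃⟩ := exists_ini_sub_mul_notMem_span hx (hIr hf₁I) n₃
  have hI' : I = Ideal.span {f₁, f₂ - c * f₁, f₃ - d * f₁} := by
    rw [hI]
    apply le_antisymm <;> rw [Ideal.span_le] <;> rintro _ (rfl | rfl | rfl) <;>
      simp only [SetLike.mem_coe, Ideal.mem_span_insert, Ideal.mem_span_singleton']
    · exact ⟨1, 0, ⟨0, 0, ⟨0, by ring⟩, by ring⟩, by ring⟩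
    · exact ⟨c, _, ⟨1, 0, ⟨0, by ring⟩, rfl⟩, by ring⟩
    · exact ⟨d, _, ⟨0, _, ⟨1, rfl⟩, rfl⟩, by ring⟩
    · exact ⟨1, 0, ⟨0, 0, ⟨0, by ring⟩, by ring⟩, by ring⟩
    · exact ⟨-c, _, ⟨1, 0, ⟨0, by ring⟩, rfl⟩, by ring⟩
    · exact ⟨-d, _, ⟨0, _, ⟨1, rfl⟩, rfl⟩, by ring⟩
  -- Subtracting `c f₁`, `d f₁` from `f₂`, `f₃` amounts to adding `c` times row 2 and `d` times row
  -- 3 to row 1; `f₁` and rows 2, 3 stay.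
  exact hP.isLinkedDeterminantal_of_normalized hx hPp (a₁ := a₁ + c * a₂ + d * a₃) (a₂ := a₂)
    (a₃ := a₃) (b₁ := b₁ + c * b₂ + d * b₃) (b₂ := b₂) (b₃ := b₃) h₁ (by rw [h₁, h₂]; ring)
    (by rw [h₁, h₃]; ring) hI' hIr hs ht (hP.prime_ini hx hPp hIr hf₁I hf₁) hF₂ hF₃ hr ha₂ ha₃
    hb₂ hb₃

end Generators

lemma IsInitialIdeal.isLinkedDeterminantal_of_spanFinrank_eq_three {R : Type u} [CommRing R]
    [IsRegularLocalRing R] {ι : Type*} {x : ι → R} (hx : IsRegularParameters x) {I : Ideal R}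
    {P : Ideal (MvPolynomial ι (ResidueField R))} (hP : IsInitialIdeal x I P) (hPp : P.IsPrime)
    (hheight : I.height = 2) (hperfect : IsPerfectIdeal I) (hbot : I ≠ ⊥)
    (hgen : I.spanFinrank = 3) (hI5 : ¬ I ≤ maximalIdeal R ^ 5) : IsLinkedDeterminantal P := by
  obtain ⟨a₁, a₂, a₃, b₁, b₂, b₃, hI⟩ := exists_eq_span_minors hheight hperfect hgen
  obtain ⟨r, hIr, hr⟩ := exists_le_pow_not_le_pow_succ hbot
  have hr4 : r ≤ 4 := by
    by_contra! h
    exact hI5 (hIr.trans (Ideal.pow_le_pow_right h))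
  -- A cyclic permutation of the rows permutes the minors cyclically, so a minor of least order can
  -- be placed first.
  have rot : ∀ f g h : R, ({f, g, h} : Set R) = {g, h, f} := fun f g h ↦ by
    rw [Set.insert_comm, Set.pair_comm]
  by_cases k₁ : a₂ * b₃ - a₃ * b₂ ∈ maximalIdeal R ^ (r + 1)
  swap
  · exact hP.isLinkedDeterminantal_of_minors hx hPp rfl rfl rfl hI hIr k₁ hgen hr4
  by_cases k₂ : a₃ * b₁ - a₁ * b₃ ∈ maximalIdeal R ^ (r + 1)
  swap
  · rw [rot] at hI
    exact hP.isLinkedDeterminantal_of_minors hx hPp rfl rfl rfl hI hIr k₂ hgen hr4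
  by_cases k₃ : a₁ * b₂ - a₂ * b₁ ∈ maximalIdeal R ^ (r + 1)
  swap
  · rw [rot, rot] at hI
    exact hP.isLinkedDeterminantal_of_minors hx hPp rfl rfl rfl hI hIr k₃ hgen hr4
  refine absurd ?_ hr
  rw [hI, Ideal.span_le]
  rintro _ (rfl | rfl | rfl)
  exacts [k₁, k₂, k₃]

end MvPolynomial

theorem mainTheorem3 {R : Type u} [CommRing R] [IsRegularLocalRing R]
    {S : Type v} [CommRing S] [IsLocalRing S]
    (I : Ideal R) (e : S ≃+* R ⧸ I)
    (hheight : I.height = 2) (hperfect : CMGr.IsPerfectIdeal I)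
    (hdomain : IsDomain (CMGr.AssociatedGradedRing (IsLocalRing.maximalIdeal S)))
    (hgen : I.spanFinrank ≤ 2 ∨
      (I.spanFinrank = 3 ∧ ¬ I ≤ IsLocalRing.maximalIdeal R ^ 5)) :
    CMGr.IsCohenMacaulayRing (CMGr.AssociatedGradedRing (IsLocalRing.maximalIdeal S)) := by
  have : IsDomain R := CMGr.isDomain_of_isRegularLocalRing
  obtain ⟨d, x, hspan, hquasi⟩ := MvPolynomial.exists_isQuasiRegular_span_eq_maximalIdeal R
  have hx : MvPolynomial.IsRegularParameters x := ⟨hspan, hquasi⟩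
  let π : R →+* S := (e.symm : (R ⧸ I) →+* S).comp (Ideal.Quotient.mk I)
  have hπ : Function.Surjective π := e.symm.surjective.comp Ideal.Quotient.mk_surjective
  have hker : RingHom.ker π = I := by
    ext f
    simp [π, RingHom.mem_ker, Ideal.Quotient.eq_zero_iff_mem]
  obtain ⟨Ψ, hΨ, hΨker⟩ := MvPolynomial.exists_surjective_associatedGradedRing x π hx hπ
  rw [hker] at hΨker
  have hP : MvPolynomial.IsInitialIdeal x I (RingHom.ker Ψ) := hΨker
  -- This is where the associated graded ring being a domain enters.
  have hPp : (RingHom.ker Ψ).IsPrime := RingHom.ker_isPrime Ψ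
  have hbot : I ≠ ⊥ := by
    rintro rfl
    rw [Ideal.height_bot] at hheight
    exact absurd hheight (by decide)
  have hL : MvPolynomial.IsLinkedDeterminantal (RingHom.ker Ψ) := by
    obtain h | ⟨h, h5⟩ := hgen
    · exact hP.isLinkedDeterminantal_of_spanFinrank_le_two hx hPp hheight hperfect.1 hbot h
    · exact hP.isLinkedDeterminantal_of_spanFinrank_eq_three hx hPp hheight hperfect hbot h h5
  obtain ⟨α, β, u, v, u', v', hK, h0, h1, h2, hspanP⟩ := hL
  exact CMGr.isCohenMacaulayRing_of_surjective Ψ hΨ hK h0 h1 h2 hspanP
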